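/- **Corollary 4.4 (convergence rate of the regularized ERM).** Let $d\in\{1,2,\dots\}$, $r\in\{0,1,2,\dots\}$, $\beta\in(0,1]$ and $\alpha=r+\beta$. Let $\mathcal H^\alpha$ be the set of functions $f:[0,1]^d\to\mathbb R$ that extend to a $C^r$ function on $\mathbb R^d$ all of whose partial derivatives of order at most $r$ are bounded by $1$ in absolute value and whose partial derivatives $g$ of order $r$ satisfy $|g(x)-g(y)|\le\|x-y\|_\infty^\beta$ for all $x,y\in\mathbb R^d$. A ReLU network of depth $L\ge 1$ and width $W=\max\{N_1,\dots,N_L\}$ (with $N_\ell\ge1$) with parameters $\theta=((A_0,b_0),\dots,(A_{L-1},b_{L-1}),A_L)$, where $A_\ell\in\mathbb R^{N_{\ell+1}\times N_\ell}$, $b_\ell\in\mathbb R^{N_{\ell+1}}$, $N_0=d$, $N_{L+1}=1$, computes $\phi_\theta(x)=A_L\phi_L(x)$, where $\phi_0(x)=x$ and $\phi_{\ell+1}(x)=\sigma(A_\ell\phi_\ell(x)+b_\ell)$ for $0\le\ell<L$, with $\sigma(t)=\max\{t,0\}$ applied componentwise. Put $$\kappa(\theta)=\|A_L\|\prod_{\ell=0}^{L-1}\max\{\|(A_\ell,b_\ell)\|,1\},\qquad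 \|A\|=\max_i\sum_j|a_{i,j}| ,$$ and let $\mathcal{NN}^1(W,L)$ be the set of the $\phi_\theta$ of width $W$ and depth $L$ with $\phi_\theta(x)\in[-1,1]$ for all $x\in\mathbb R^d$. Let $\mu$ be a probability measure with $\mu([0,1]^d)=1$, let $f_0\in\mathcal H^\alpha$, let $X_1,\dots,X_n$ be i.i.d. with law $\mu$, and let $Y_i=f_0(X_i)$ (no noise). For $\lambda>0$ put $$\mathcal L_{n,\lambda}(\phi_\theta)=\frac1n\sum_{i=1}^n(\phi_\theta(X_i)-Y_i)^2+\lambda\kappa(\theta).$$ There is a constant $c>0$, depending only on $d$ and $\alpha$, such that for every $L\ge 2\lceil\log_2(d+r)\rceil+3$ and all constants $a_1,a_2,a_3>0$ there is a constant $C>0$, depending only on $d,\alpha,L,a_1,a_2,a_3$, with the following property. For all integers $n\ge2$ and $W\ge c\,n^{(2d+\alpha)/(4d+8\alpha+4)}$, all $\lambda$ with $a_1n^{-1/2}\le\lambda\le a_2n^{-1/2}$, all $\epsilon_{opt}$ with $0\le\epsilon_{opt}\le a_3n^{-\alpha/(d+2\alpha+1)}$, all $\mu$, $f_0$ and $(X_i)$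 as above, and every (random) estimator $\widehat\phi_{n,\lambda}=\phi_{\widehat\theta_{n,\lambda}}\in\mathcal{NN}^1(W,L)$ satisfying almost surely $$\mathcal L_{n,\lambda}(\widehat\phi_{n,\lambda})\le\inf_{\phi_\theta\in\mathcal{NN}^1(W,L)}\mathcal L_{n,\lambda}(\phi_\theta)+\epsilon_{opt},$$ one has $$\mathbb E\left[\|\widehat\phi_{n,\lambda}-f_0\|_{L^2(\mu)}^2\right]\le C\,n^{-\alpha/(d+2\alpha+1)}\log n .$$ -/

import Mathlib

open MeasureTheory ProbabilityTheory

noncomputable section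

/-- Dimensions of the non-output layers: `layerDim d N 0 = d` is the input dimension and
`layerDim d N (ℓ + 1) = N ℓ` is the number of neurons in the `(ℓ + 1)`-st hidden layer. -/
abbrev layerDim (d : ℕ) (N : ℕ → ℕ) : ℕ → ℕ
  | 0 => d
  | ℓ + 1 => N ℓ

/-- The parameters `θ = ((A₀, b₀), …, (A_{L-1}, b_{L-1}), A_L)` of a ReLU network with input
dimension `d`, output dimension `k` and `L` hidden layers, together with the number
`N ℓ ≥ 1` of neurons of the `(ℓ + 1)`-st hidden layer.  Only the entries with `ℓ < L` of the
sequences `N`, `A`, `b` matter; the others are padding and never used below. -/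
structure ReLUNet (d k L : ℕ) where
  N : ℕ → ℕ
  N_pos : ∀ ℓ < L, 1 ≤ N ℓ
  A : (ℓ : ℕ) → Matrix (Fin (layerDim d N (ℓ + 1))) (Fin (layerDim d N ℓ)) ℝ
  b : (ℓ : ℕ) → Fin (layerDim d N (ℓ + 1)) → ℝ
  out : Matrix (Fin k) (Fin (layerDim d N L)) ℝ

namespace ReLUNet

variable {d k L : ℕ}

/-- The output of the `ℓ`-th layer, `φ₀(x) = x` and `φ_{ℓ+1}(x) = σ(A_ℓ φ_ℓ(x) + b_ℓ)`,
where `σ(t) = max t 0` acts componentwise. -/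
def hidden (θ : ReLUNet d k L) (x : Fin d → ℝ) : (ℓ : ℕ) → Fin (layerDim d θ.N ℓ) → ℝ
  | 0 => x
  | ℓ + 1 => fun i => max (((θ.A ℓ).mulVec (hidden θ x ℓ) + θ.b ℓ) i) 0

/-- The function `φ_θ(x) = A_L φ_L(x)` computed by the network. -/
def eval (θ : ReLUNet d k L) (x : Fin d → ℝ) : Fin k → ℝ :=
  θ.out.mulVec (θ.hidden x L)

/-- The width `max {N₁, …, N_L}`. -/
def width (θ : ReLUNet d k L) : ℕ := (Finset.range L).sup θ.N

section

-- The operator norm with respect to the sup norms, i.e. the maximal `1`-norm of a row.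
attribute [local instance] Matrix.linftyOpNormedAddCommGroup

/-- `κ(θ) = ‖A_L‖ ∏_{ℓ < L} max {‖(A_ℓ, b_ℓ)‖, 1}`. -/
def kappa (θ : ReLUNet d k L) : ℝ :=
  ‖θ.out‖ * ∏ ℓ ∈ Finset.range L,
    max ‖Matrix.fromCols (θ.A ℓ) (Matrix.replicateCol (Fin 1) (θ.b ℓ))‖ 1

end

/-- The parameters of the functions in `NN^B_{d,k}(W, L)`: the width is `W`, the depth is `L`,
and all values of `φ_θ` on the whole space lie in `[-B, B]^k`. -/
def boundedClass (d k W L : ℕ) (B : ℝ) : Set (ReLUNet d k L) :=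
  {θ | θ.width = W ∧ ∀ (x : Fin d → ℝ) (i : Fin k), θ.eval x i ∈ Set.Icc (-B) B}

end ReLUNet

/-- The mixed partial derivative `∂_{s 0} ∂_{s 1} ⋯ ∂_{s (j-1)} f (x)` of order `j`.  For functions
of class `C^j` every `∂^s` with a multi-index `s` of order `j` is of this form. -/
def mixedPartial {d j : ℕ} (s : Fin j → Fin d) (f : (Fin d → ℝ) → ℝ) (x : Fin d → ℝ) : ℝ :=
  iteratedFDeriv ℝ j f x (fun m => Pi.single (s m) 1)

/-- The (unit ball) Hölder class `H^{r+β}(ℝ^d)`: `f` is of class `C^r`, its partial derivatives up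
to order `r` are bounded by `1`, and those of order `r` are `β`-Hölder with constant `1` with
respect to the sup norm (the norm of `Fin d → ℝ`). -/
def HolderClass (d r : ℕ) (β : ℝ) : Set ((Fin d → ℝ) → ℝ) :=
  {f | ContDiff ℝ (r : ℕ) f ∧
    (∀ j ≤ r, ∀ (s : Fin j → Fin d) (x : Fin d → ℝ), |mixedPartial s f x| ≤ 1) ∧
    ∀ (s : Fin r → Fin d) (x y : Fin d → ℝ),
      |mixedPartial s f x - mixedPartial s f y| ≤ ‖x - y‖ ^ β}

/-- `f` agrees on the cube `[0,1]^d` with a function of the class `H^{r+β}(ℝ^d)`.  (Only the values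
of `f` on the cube are relevant.) -/
def HolderOnCube (d r : ℕ) (β : ℝ) : Set ((Fin d → ℝ) → ℝ) :=
  {f | ∃ g ∈ HolderClass d r β, Set.EqOn f g (Set.Icc 0 1)}

/-- The regularized empirical risk
`L_{n,λ}(φ_θ) = (1/n) ∑ᵢ (φ_θ(xᵢ) - yᵢ)² + λ κ(θ)` of a network on the data `(xᵢ, yᵢ)`. -/
def regularizedRisk {d L n : ℕ} (x : Fin n → Fin d → ℝ) (y : Fin n → ℝ) (lam : ℝ)
    (θ : ReLUNet d 1 L) : ℝ :=
  (1 / (n : ℝ)) * ∑ i, (θ.eval (x i) 0 - y i) ^ 2 + lam * θ.kappa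

/-- `θ` is an `ε`-optimal solution of the regularized empirical risk minimization over
`NN^1_{d,1}(W, L)`. -/
def IsApproxRegularizedERM {d L n : ℕ} (W : ℕ) (x : Fin n → Fin d → ℝ) (y : Fin n → ℝ)
    (lam ε : ℝ) (θ : ReLUNet d 1 L) : Prop :=
  θ ∈ ReLUNet.boundedClass d 1 W L 1 ∧
    regularizedRisk x y lam θ ≤
      sInf (regularizedRisk x y lam '' ReLUNet.boundedClass d 1 W L 1) + ε

end

/-! The penalty turns the problem into one on a ball {κ ≤ K}, on which the generalization error does
not depend on the width. Write S = d + 2α + 1, ν = n^(1/(2S)) and ρ = ν^(-2α), which is the claimed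
rate without the logarithm.

Approximation (`exists_net_rate`): a competitor θ₀ has κ(θ₀) = O(ν^(d+1)) and sup error O(ν^(-α)) on
the cube. Without noise its empirical loss is O(ρ), and its penalty is of order n^(-1/2) ν^(d+1) =
ν^(d+1-S) = ρ. An almost minimizer therefore has regularized risk O(ρ), and the lower bound on λ
forces κ = O(ν^(d+1)) for it too, whatever the sample.

Generalization (`uniform_deviation`): over {κ ≤ K} the expected largest excess of the true over the
empirical loss is O(K/√n), again of order ρ for K of order ν^(d+1). This follows from
symmetrization, contraction for the square loss, and a layer-by-layer Rademacher bound
(`unitNeurons_signs_le`): positive homogeneity puts a network with κ ≤ K into K times an absolutely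
convex hull, taking the hull costs nothing, and each ReLU costs a factor 2.

The competitor (`exists_net_grid`) glues Taylor polynomials at the nodes of a grid of mesh 1/N by a
partition of unity of tensor products of hats. Products become combinations of powers by
polarization, and powers become combinations of k ReLUs by interpolation, with error O(k⁻²). The
approximate product vanishes exactly when a factor does, so at each point at most 2^d cells
contribute an error. The hats have slope N and there are O(N^d) cells, whence κ = O(N^(d+1)) and
width O(N^d k). The choice N ≈ ν, k ≈ ν^(α/2) balances the errors and gives the width in the
theorem. -/

noncomputable section

/-! ### Averages over sign vectors and the contraction principle. -/

section Signs

variable {ι : Type*} [DecidableEq ι]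

/-- Changing the sign of the `i`-th entry of a sign vector. -/
def flipSign (i : ι) : (ι → ℤˣ) ≃ (ι → ℤˣ) := Equiv.mulLeft (Pi.mulSingle i (-1))

lemma flipSign_same (i : ι) (ε : ι → ℤˣ) : flipSign i ε i = -ε i := by
  simp [flipSign]

lemma flipSign_ne {i j : ι} (h : j ≠ i) (ε : ι → ℤˣ) : flipSign i ε j = ε j := by
  simp [flipSign, h]

lemma flipSign_flipSign (i : ι) (ε : ι → ℤˣ) : flipSign i (flipSign i ε) = ε := by
  funext j
  by_cases h : j = i
  · subst h; simp [flipSign_same]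
  · simp [flipSign_ne h]

lemma sign_sq (u : ℤˣ) : ((u : ℤ) : ℝ) * ((u : ℤ) : ℝ) = 1 := by
  rcases Int.units_eq_one_or u with h | h <;> simp [h]

lemma abs_sign (u : ℤˣ) : |((u : ℤ) : ℝ)| = 1 := by
  rcases Int.units_eq_one_or u with h | h <;> simp [h]

variable [Fintype ι]

lemma card_signs : Fintype.card (ι → ℤˣ) = 2 ^ Fintype.card ι := by
  simp

/-- A sum over sign vectors vanishes if flipping one sign changes the sign of the summand. -/
lemma sum_signs_eq_zero (i : ι) (F : (ι → ℤˣ) → ℝ) (h : ∀ ε, F (flipSign i ε) = -F ε) :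
    ∑ ε, F ε = 0 := by
  have h1 : ∑ ε, F (flipSign i ε) = ∑ ε, F ε := Equiv.sum_comp (flipSign i) F
  simp only [h, Finset.sum_neg_distrib] at h1
  linarith

lemma sum_signs_mul (i j : ι) :
    ∑ ε : ι → ℤˣ, ((ε i : ℤ) : ℝ) * ((ε j : ℤ) : ℝ) =
      if i = j then (2 : ℝ) ^ Fintype.card ι else 0 := by
  split_ifs with h
  · subst h
    simp [sign_sq]
  · refine sum_signs_eq_zero i _ fun ε => ?_
    rw [flipSign_same, flipSign_ne (Ne.symm h)]
    simp

lemma sum_signs_sq (y : ι → ℝ) :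
    ∑ ε : ι → ℤˣ, (∑ i, ((ε i : ℤ) : ℝ) * y i) ^ 2 = 2 ^ Fintype.card ι * ∑ i, y i ^ 2 := by
  simp_rw [sq, Finset.sum_mul_sum]
  rw [Finset.sum_comm, Finset.mul_sum]
  refine Finset.sum_congr rfl fun i _ => ?_
  rw [Finset.sum_comm]
  have : ∀ j, ∑ ε : ι → ℤˣ, ((ε i : ℤ) : ℝ) * y i * (((ε j : ℤ) : ℝ) * y j) =
      (if i = j then (2 : ℝ) ^ Fintype.card ι else 0) * (y i * y j) := by
    intro j
    rw [← sum_signs_mul, Finset.sum_mul]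
    exact Finset.sum_congr rfl fun ε _ => by ring
  simp [this]

/-- Khintchine's upper bound for signed sums of numbers of absolute value at most `1`. -/
lemma sum_signs_abs_le (y : ι → ℝ) (hy : ∀ i, |y i| ≤ 1) :
    ∑ ε : ι → ℤˣ, |∑ i, ((ε i : ℤ) : ℝ) * y i| ≤
      2 ^ Fintype.card ι * √(Fintype.card ι) := by
  -- Cauchy–Schwarz over the sign vectors reduces the claim to the second moment, which
  -- orthogonality of the signs computes.
  have h1 : (∑ ε : ι → ℤˣ, |∑ i, ((ε i : ℤ) : ℝ) * y i|) ^ 2 ≤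
      (2 ^ Fintype.card ι * √(Fintype.card ι)) ^ 2 := by
    refine (sq_sum_le_card_mul_sum_sq).trans ?_
    simp only [sq_abs, sum_signs_sq, Finset.card_univ, card_signs]
    rw [mul_pow, Real.sq_sqrt (Nat.cast_nonneg _)]
    push_cast
    have : ∑ i, y i ^ 2 ≤ Fintype.card ι := by
      calc ∑ i, y i ^ 2 ≤ ∑ _i : ι, (1 : ℝ) :=
            Finset.sum_le_sum fun i _ => (sq_le_one_iff_abs_le_one _).2 (hy i)
        _ = Fintype.card ι := by simp
    calc (2 : ℝ) ^ Fintype.card ι * (2 ^ Fintype.card ι * ∑ i, y i ^ 2)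
        ≤ 2 ^ Fintype.card ι * (2 ^ Fintype.card ι * Fintype.card ι) := by gcongr
      _ = _ := by ring
  exact le_of_sq_le_sq h1 (by positivity)

/-- One step of the contraction principle: in one coordinate, the values `g` may be replaced by
values `f` that are at most as far apart. -/
lemma contraction_step {κ : Type*} (i : ι) (a : (ι → ℤˣ) → κ → ℝ)
    (ha : ∀ ε, a (flipSign i ε) = a ε) (f g : κ → ℝ) (hfg : ∀ k l, |f k - f l| ≤ |g k - g l|)
    (B : ℝ) (hB : ∀ t : (ι → ℤˣ) → κ, ∑ ε, (a ε (t ε) + ((ε i : ℤ) : ℝ) * g (t ε)) ≤ B)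
    (t : (ι → ℤˣ) → κ) : ∑ ε, (a ε (t ε) + ((ε i : ℤ) : ℝ) * f (t ε)) ≤ B := by
  classical
  set s := flipSign i with hs
  -- Each ε is paired with its flip at `i`: `a` agrees on the two and the signs at `i` are opposite,
  -- so only differences of values of `u` remain.
  have hdouble : ∀ (u : κ → ℝ) (t : (ι → ℤˣ) → κ),
      2 * ∑ ε, (a ε (t ε) + ((ε i : ℤ) : ℝ) * u (t ε)) =
        ∑ ε, (a ε (t ε) + a ε (t (s ε)) + ((ε i : ℤ) : ℝ) * (u (t ε) - u (t (s ε)))) := by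
    intro u t
    have h1 := Equiv.sum_comp s (fun ε => a ε (t ε) + ((ε i : ℤ) : ℝ) * u (t ε))
    rw [two_mul]
    nth_rewrite 1 [← h1]
    rw [← Finset.sum_add_distrib]
    refine Finset.sum_congr rfl fun ε _ => ?_
    rw [ha, hs, flipSign_same]
    push_cast
    ring
  -- Within a pair the two choices are exchanged if the `g`-difference has the wrong sign. The
  -- `a`-terms enter symmetrically, so this is free, and the `g`-term becomes an absolute value that
  -- dominates the `f`-term.
  let t' : (ι → ℤˣ) → κ := fun ε =>
    if 0 ≤ ((ε i : ℤ) : ℝ) * (g (t ε) - g (t (s ε))) then t ε else t (s ε)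
  have key : 2 * ∑ ε, (a ε (t ε) + ((ε i : ℤ) : ℝ) * f (t ε)) ≤
      2 * ∑ ε, (a ε (t' ε) + ((ε i : ℤ) : ℝ) * g (t' ε)) := by
    rw [hdouble, hdouble]
    refine Finset.sum_le_sum fun ε _ => ?_
    have hf : ((ε i : ℤ) : ℝ) * (f (t ε) - f (t (s ε))) ≤ |g (t ε) - g (t (s ε))| := by
      refine (le_abs_self _).trans ?_
      rw [abs_mul, abs_sign, one_mul]
      exact hfg _ _
    have hg : |((ε i : ℤ) : ℝ) * (g (t ε) - g (t (s ε)))| = |g (t ε) - g (t (s ε))| := by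
      rw [abs_mul, abs_sign, one_mul]
    have hss : s (s ε) = ε := flipSign_flipSign i ε
    have hsi : (((s ε) i : ℤ) : ℝ) = -((ε i : ℤ) : ℝ) := by rw [hs, flipSign_same]; simp
    rcases lt_trichotomy (((ε i : ℤ) : ℝ) * (g (t ε) - g (t (s ε)))) 0 with h | h | h
    · have h1 : t' ε = t (s ε) := if_neg (not_le.2 h)
      have h2 : t' (s ε) = t ε := by
        have : ¬ 0 ≤ (((s ε) i : ℤ) : ℝ) * (g (t (s ε)) - g (t (s (s ε)))) := by
          rw [hss, hsi]; linarith
        simp only [t', if_neg this, hss]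
      rw [h1, h2]
      rw [← hg, abs_of_neg h] at hf
      linarith
    · have h1 : t' ε = t ε := if_pos h.ge
      have h2 : t' (s ε) = t (s ε) := by
        have : 0 ≤ (((s ε) i : ℤ) : ℝ) * (g (t (s ε)) - g (t (s (s ε)))) := by
          rw [hss, hsi]; linarith
        simp only [t', if_pos this]
      rw [h1, h2]
      rw [← hg, h, abs_zero] at hf
      linarith
    · have h1 : t' ε = t ε := if_pos h.le
      have h2 : t' (s ε) = t (s ε) := by
        have : 0 ≤ (((s ε) i : ℤ) : ℝ) * (g (t (s ε)) - g (t (s (s ε)))) := by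
          rw [hss, hsi]; linarith
        simp only [t', if_pos this]
      rw [h1, h2]
      rw [← hg, abs_of_pos h] at hf
      linarith
  have := hB t'
  linarith

/-- The contraction principle for Rademacher averages. -/
lemma contraction_signs {κ : Type*} (f g : κ → ι → ℝ)
    (hfg : ∀ i k l, |f k i - f l i| ≤ |g k i - g l i|) (B : ℝ)
    (hB : ∀ t : (ι → ℤˣ) → κ, ∑ ε, ∑ i, ((ε i : ℤ) : ℝ) * g (t ε) i ≤ B)
    (t : (ι → ℤˣ) → κ) : ∑ ε, ∑ i, ((ε i : ℤ) : ℝ) * f (t ε) i ≤ B := by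
  classical
  -- The coordinates pass from `g` to `f` one at a time; those other than `j` form a term that does
  -- not see the sign at `j`.
  have main : ∀ S : Finset ι, ∀ t : (ι → ℤˣ) → κ,
      ∑ ε, ∑ i, ((ε i : ℤ) : ℝ) * (if i ∈ S then f (t ε) i else g (t ε) i) ≤ B := by
    intro S
    induction S using Finset.induction_on with
    | empty => simpa using hB
    | insert j S hj ih =>
      intro t
      have hsplit : ∀ (h : κ → ι → ℝ) (ε : ι → ℤˣ) (k : κ),
          ∑ i, ((ε i : ℤ) : ℝ) * h k i =
            (∑ i ∈ Finset.univ.erase j, ((ε i : ℤ) : ℝ) * h k i) + ((ε j : ℤ) : ℝ) * h k j :=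
        fun h ε k => (Finset.sum_erase_add _ _ (Finset.mem_univ j)).symm
      have hstep := contraction_step j
        (fun ε k => ∑ i ∈ Finset.univ.erase j, ((ε i : ℤ) : ℝ) * (if i ∈ S then f k i else g k i))
        (fun ε => by
          funext k
          refine Finset.sum_congr rfl fun i hi => ?_
          rw [flipSign_ne (Finset.ne_of_mem_erase hi)])
        (fun k => f k j) (fun k => g k j) (hfg j) B
        (fun t => by
          refine le_of_eq_of_le (Finset.sum_congr rfl fun ε _ => ?_) (ih t)
          rw [hsplit (fun k i => if i ∈ S then f k i else g k i), if_neg hj]) t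
      refine le_of_eq_of_le (Finset.sum_congr rfl fun ε _ => ?_) hstep
      rw [hsplit (fun k i => if i ∈ insert j S then f k i else g k i),
        if_pos (Finset.mem_insert_self j S)]
      congr 1
      refine Finset.sum_congr rfl fun i hi => ?_
      have : i ∈ insert j S ↔ i ∈ S := by
        simp [Finset.ne_of_mem_erase hi]
      simp only [this]
  simpa using main Finset.univ t

end Signs

/-! ### Rademacher complexity, layer by layer. -/

section Peeling

variable {X : Type*}

/-- Finite linear combinations of elements of `S` whose coefficients have absolute sum at most
`1`. -/
def absComb (S : Set (X → ℝ)) : Set (X → ℝ) :=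
  {h | ∃ (κ : Type) (_ : Fintype κ) (a : κ → ℝ) (g : κ → X → ℝ),
    (∀ j, g j ∈ S) ∧ ∑ j, |a j| ≤ 1 ∧ h = fun x => ∑ j, a j * g j x}

/-- The functions computed by single neurons in the `ℓ`-th layer of a network all of whose layers
have norm at most `1`. -/
def unitNeurons (d : ℕ) : ℕ → Set ((Fin d → ℝ) → ℝ)
  | 0 => {f | (∃ j, f = fun x => x j) ∨ f = fun _ => 1}
  | ℓ + 1 => {f | ∃ h ∈ absComb (unitNeurons d ℓ), f = fun x => max (h x) 0}

/-- The constant survives every layer, so a bias can be treated as the coefficient of one more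
neuron. -/
lemma one_mem_unitNeurons (d ℓ : ℕ) : (fun _ => 1) ∈ unitNeurons d ℓ := by
  induction ℓ with
  | zero => exact Or.inr rfl
  | succ ℓ ih =>
    exact ⟨fun _ => 1, ⟨Unit, inferInstance, fun _ => 1, fun _ _ => 1, fun _ => ih, by simp,
      by simp⟩, by simp⟩

/-- On an absolutely convex hull a linear functional is no larger in modulus than at its best
generator. Nonemptiness of `S` serves the empty combination. -/
lemma exists_mem_of_absComb {n : ℕ} {S : Set (X → ℝ)} (hS : S.Nonempty) {h : X → ℝ}
    (hh : h ∈ absComb S) (x : Fin n → X) (ε : Fin n → ℤˣ) :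
    ∃ g ∈ S, |∑ i, ((ε i : ℤ) : ℝ) * h (x i)| ≤ |∑ i, ((ε i : ℤ) : ℝ) * g (x i)| := by
  obtain ⟨κ, _, a, g, hg, ha, rfl⟩ := hh
  have hsum : ∑ i, ((ε i : ℤ) : ℝ) * ∑ j, a j * g j (x i) =
      ∑ j, a j * ∑ i, ((ε i : ℤ) : ℝ) * g j (x i) := by
    simp_rw [Finset.mul_sum]
    rw [Finset.sum_comm]
    exact Finset.sum_congr rfl fun j _ => Finset.sum_congr rfl fun i _ => by ring
  rcases isEmpty_or_nonempty κ with hκ | hκ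
  · obtain ⟨g₀, hg₀⟩ := hS
    exact ⟨g₀, hg₀, by simp⟩
  · obtain ⟨j₀, hj₀⟩ := Finite.exists_max fun j => |∑ i, ((ε i : ℤ) : ℝ) * g j (x i)|
    refine ⟨g j₀, hg j₀, ?_⟩
    simp only [hsum]
    calc |∑ j, a j * ∑ i, ((ε i : ℤ) : ℝ) * g j (x i)|
        ≤ ∑ j, |a j| * |∑ i, ((ε i : ℤ) : ℝ) * g j₀ (x i)| := by
          refine (Finset.abs_sum_le_sum_abs _ _).trans (Finset.sum_le_sum fun j _ => ?_)
          rw [abs_mul]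
          exact mul_le_mul_of_nonneg_left (hj₀ j) (abs_nonneg _)
      _ = (∑ j, |a j|) * |∑ i, ((ε i : ℤ) : ℝ) * g j₀ (x i)| := by rw [Finset.sum_mul]
      _ ≤ _ := by
          have := mul_le_mul_of_nonneg_right ha
            (abs_nonneg (∑ i, ((ε i : ℤ) : ℝ) * g j₀ (x i)))
          simpa using this

/-- The Rademacher complexity of the single neurons at most doubles from layer to layer. -/
lemma unitNeurons_signs_le (d : ℕ) {n : ℕ} (x : Fin n → Fin d → ℝ)
    (hx : ∀ i, x i ∈ Set.Icc (0 : Fin d → ℝ) 1) (ℓ : ℕ) :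
    ∀ t : (Fin n → ℤˣ) → ((Fin d → ℝ) → ℝ), (∀ ε, t ε ∈ unitNeurons d ℓ) →
      ∑ ε : Fin n → ℤˣ, |∑ i, ((ε i : ℤ) : ℝ) * t ε (x i)| ≤ 2 ^ ℓ * ((d + 1) * (2 ^ n * √n)) := by
  induction ℓ with
  | zero =>
    intro t ht
    have hpt : ∀ ε : Fin n → ℤˣ, |∑ i, ((ε i : ℤ) : ℝ) * t ε (x i)| ≤
        (∑ j : Fin d, |∑ i, ((ε i : ℤ) : ℝ) * x i j|) + |∑ i, ((ε i : ℤ) : ℝ) * 1| := by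
      intro ε
      rcases ht ε with ⟨j, hj⟩ | h1
      · rw [hj]
        have := Finset.single_le_sum (f := fun j => |∑ i, ((ε i : ℤ) : ℝ) * x i j|)
          (fun j _ => abs_nonneg _) (Finset.mem_univ j)
        have h0 := abs_nonneg (∑ i, ((ε i : ℤ) : ℝ) * 1)
        linarith
      · rw [h1]
        have := Finset.sum_nonneg (s := Finset.univ)
          (f := fun j : Fin d => |∑ i, ((ε i : ℤ) : ℝ) * x i j|) (fun j _ => abs_nonneg _)
        linarith
    refine (Finset.sum_le_sum fun ε _ => hpt ε).trans ?_
    rw [Finset.sum_add_distrib, Finset.sum_comm]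
    have h1 := sum_signs_abs_le (ι := Fin n) (fun _ => 1) (by simp)
    have h2 : ∀ j : Fin d, ∑ ε : Fin n → ℤˣ, |∑ i, ((ε i : ℤ) : ℝ) * x i j| ≤ 2 ^ n * √n := by
      intro j
      have := sum_signs_abs_le (fun i => x i j) (fun i => by
        rw [abs_le]
        exact ⟨by linarith [(hx i).1 j, show (0 : Fin d → ℝ) j = 0 from rfl], (hx i).2 j⟩)
      simpa using this
    have h3 := Finset.sum_le_sum (s := Finset.univ) fun (j : Fin d) _ => h2 j
    simp only [Finset.sum_const, Finset.card_univ, Fintype.card_fin, nsmul_eq_mul] at h3 h1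
    linarith
  | succ ℓ ih =>
    intro t ht
    set B : ℝ := 2 ^ ℓ * ((d + 1) * (2 ^ n * √n)) with hB
    have hcomb : ∀ t : (Fin n → ℤˣ) → absComb (unitNeurons d ℓ),
        ∑ ε : Fin n → ℤˣ, ∑ i, ((ε i : ℤ) : ℝ) * (t ε : (Fin d → ℝ) → ℝ) (x i) ≤ B := by
      intro t
      choose g hg hle using fun ε =>
        exists_mem_of_absComb ⟨_, one_mem_unitNeurons d ℓ⟩ (t ε).2 x ε
      exact (Finset.sum_le_sum fun ε _ => (le_abs_self _).trans (hle ε)).trans (ih g hg)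
    have hrelu := contraction_signs
      (fun (h : absComb (unitNeurons d ℓ)) i => max ((h : (Fin d → ℝ) → ℝ) (x i)) 0)
      (fun (h : absComb (unitNeurons d ℓ)) i => (h : (Fin d → ℝ) → ℝ) (x i))
      (fun i k l => by
        have := abs_max_sub_max_le_abs ((k : (Fin d → ℝ) → ℝ) (x i))
          ((l : (Fin d → ℝ) → ℝ) (x i)) 0
        exact this) B hcomb
    choose h hh hth using ht
    have hzero : (fun _ => 0) ∈ absComb (unitNeurons d ℓ) :=
      ⟨Empty, inferInstance, fun _ => 0, fun _ _ => 0, by simp, by simp, by simp⟩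
    -- The zero function belongs to the class, so a selection may drop every negative sum; this
    -- bounds the sum of positive parts.
    have hpos : ∀ u : (Fin n → ℤˣ) → ((Fin d → ℝ) → ℝ), (∀ ε, u ε ∈ absComb (unitNeurons d ℓ)) →
        ∑ ε : Fin n → ℤˣ, max (∑ i, ((ε i : ℤ) : ℝ) * max (u ε (x i)) 0) 0 ≤ B := by
      intro u hu
      classical
      refine le_of_eq_of_le (Finset.sum_congr rfl fun ε _ => ?_) (hrelu fun ε =>
        if 0 ≤ ∑ i, ((ε i : ℤ) : ℝ) * max (u ε (x i)) 0 then ⟨u ε, hu ε⟩ else ⟨_, hzero⟩)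
      split_ifs with hc
      · exact max_eq_left hc
      · simpa using (not_le.1 hc).le
    have hneg := hpos (fun ε => h (-ε)) (fun ε => hh _)
    rw [← Equiv.sum_comp (Equiv.neg _)] at hneg
    -- The modulus is the positive part at ε plus that at -ε. This is the source of the factor 2 per
    -- layer.
    have habs : ∀ ε : Fin n → ℤˣ, |∑ i, ((ε i : ℤ) : ℝ) * t ε (x i)| =
        max (∑ i, ((ε i : ℤ) : ℝ) * max (h ε (x i)) 0) 0 +
          max (∑ i, (((-ε) i : ℤ) : ℝ) * max (h ε (x i)) 0) 0 := by
      intro ε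
      rw [hth]
      have : ∑ i, (((-ε) i : ℤ) : ℝ) * max (h ε (x i)) 0 =
          -∑ i, ((ε i : ℤ) : ℝ) * max (h ε (x i)) 0 := by
        rw [← Finset.sum_neg_distrib]
        exact Finset.sum_congr rfl fun i _ => by simp
      rw [this]
      simp only [max_zero_add_max_neg_zero_eq_abs_self]
    simp only [habs, Finset.sum_add_distrib]
    have h1 := hpos h hh
    simp only [Equiv.neg_apply, neg_neg] at hneg
    rw [pow_succ]
    linarith

end Peeling

/-! ### Complexity of networks with bounded κ. -/

section Norms

attribute [local instance] Matrix.linftyOpNormedAddCommGroup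

lemma row_sum_le_linfty_norm {m n : Type*} [Fintype m] [Fintype n] (A : Matrix m n ℝ) (i : m) :
    ∑ j, |A i j| ≤ ‖A‖ := by
  rw [Matrix.linfty_opNorm_def]
  have h := Finset.le_sup (f := fun i => ∑ j, ‖A i j‖₊) (Finset.mem_univ i)
  have h' := NNReal.coe_le_coe.2 h
  simpa using h'

lemma linfty_norm_le {m n : Type*} [Fintype m] [Fintype n] (A : Matrix m n ℝ) {M : ℝ}
    (hM : 0 ≤ M) (h : ∀ i, ∑ j, |A i j| ≤ M) : ‖A‖ ≤ M := by
  rw [Matrix.linfty_opNorm_def]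
  lift M to NNReal using hM
  rw [NNReal.coe_le_coe]
  refine Finset.sup_le fun i _ => ?_
  rw [← NNReal.coe_le_coe]
  simpa using h i

namespace ReLUNet

variable {d k L : ℕ}

/-- The product of the norms of the first `ℓ` layers. -/
def layerNorms (θ : ReLUNet d k L) (ℓ : ℕ) : ℝ :=
  ∏ ℓ ∈ Finset.range ℓ, max ‖Matrix.fromCols (θ.A ℓ) (Matrix.replicateCol (Fin 1) (θ.b ℓ))‖ 1

lemma one_le_layerNorms (θ : ReLUNet d k L) (ℓ : ℕ) : 1 ≤ θ.layerNorms ℓ :=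
  Finset.prod_induction _ (fun x : ℝ => 1 ≤ x) (fun _ _ => one_le_mul_of_one_le_of_one_le) le_rfl
    fun _ _ => le_max_right _ _

lemma kappa_eq (θ : ReLUNet d k L) : θ.kappa = ‖θ.out‖ * θ.layerNorms L := rfl

lemma kappa_nonneg (θ : ReLUNet d k L) : 0 ≤ θ.kappa :=
  mul_nonneg (norm_nonneg _) (zero_le_one.trans (θ.one_le_layerNorms L))

/-- ReLU is positively homogeneous, so every layer can be divided by the norms accumulated so far.
The bias is divided by `P * M` instead of `M`; its row stays of norm at most 1 because `P ≥ 1`,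
which is what the maximum with 1 in κ provides. -/
lemma hidden_div_mem_unitNeurons (θ : ReLUNet d k L) (ℓ : ℕ) :
    ∀ i, (fun x => θ.hidden x ℓ i / θ.layerNorms ℓ) ∈ unitNeurons d ℓ := by
  induction ℓ with
  | zero =>
    intro i
    exact Or.inl ⟨i, by simp [hidden, layerNorms]⟩
  | succ ℓ ih =>
    intro i
    set P := θ.layerNorms ℓ with hP
    set M := max ‖Matrix.fromCols (θ.A ℓ) (Matrix.replicateCol (Fin 1) (θ.b ℓ))‖ 1 with hM
    have hP1 : 1 ≤ P := θ.one_le_layerNorms ℓ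
    have hM1 : 1 ≤ M := le_max_right _ _
    have hsucc : θ.layerNorms (ℓ + 1) = P * M := Finset.prod_range_succ _ _
    have hrow : ∑ j, |θ.A ℓ i j| + |θ.b ℓ i| ≤ M := by
      have := row_sum_le_linfty_norm
        (Matrix.fromCols (θ.A ℓ) (Matrix.replicateCol (Fin 1) (θ.b ℓ))) i
      refine le_trans ?_ (le_max_left _ 1)
      simpa [Fintype.sum_sum_type] using this
    refine ⟨fun x => ∑ j, (θ.A ℓ i j / M) * (θ.hidden x ℓ j / P) + (θ.b ℓ i / (P * M)) * 1,
      ⟨Fin (layerDim d θ.N ℓ) ⊕ Unit, inferInstance,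
        Sum.elim (fun j => θ.A ℓ i j / M) (fun _ => θ.b ℓ i / (P * M)),
        Sum.elim (fun j x => θ.hidden x ℓ j / P) (fun _ _ => 1), ?_, ?_, ?_⟩, ?_⟩
    · rintro (j | j)
      · exact ih j
      · exact one_mem_unitNeurons d ℓ
    · simp only [Fintype.sum_sum_type, Sum.elim_inl, Sum.elim_inr, Finset.univ_unique,
        Finset.sum_singleton, abs_div, abs_mul, abs_of_pos (zero_lt_one.trans_le hM1),
        abs_of_pos (zero_lt_one.trans_le hP1)]
      have h1 : |θ.b ℓ i| / (P * M) ≤ |θ.b ℓ i| / M := by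
        apply div_le_div_of_nonneg_left (abs_nonneg _) (by linarith)
        nlinarith
      rw [← Finset.sum_div]
      calc _ ≤ (∑ j, |θ.A ℓ i j|) / M + |θ.b ℓ i| / M := by gcongr
        _ = (∑ j, |θ.A ℓ i j| + |θ.b ℓ i|) / M := by ring
        _ ≤ 1 := (div_le_one (by linarith)).2 hrow
    · funext x
      simp [Fintype.sum_sum_type]
    · funext x
      have hpos : 0 < P * M := mul_pos (by linarith) (by linarith)
      rw [hsucc]
      have h2 : ∑ j, (θ.A ℓ i j / M) * (θ.hidden x ℓ j / P) + (θ.b ℓ i / (P * M)) * 1 =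
          ((θ.A ℓ).mulVec (θ.hidden x ℓ) + θ.b ℓ) i / (P * M) := by
        have : ∑ j, (θ.A ℓ i j / M) * (θ.hidden x ℓ j / P) =
            (∑ j, θ.A ℓ i j * θ.hidden x ℓ j) / (P * M) := by
          rw [Finset.sum_div]
          exact Finset.sum_congr rfl fun j _ => by
            rw [div_mul_div_comm, mul_comm M P]
        rw [this]
        simp only [Matrix.mulVec, dotProduct, Pi.add_apply]
        ring
      refine Eq.trans ?_ (congrArg (fun z => max z 0) h2.symm)
      change max (((θ.A ℓ).mulVec (θ.hidden x ℓ) + θ.b ℓ) i) 0 / (P * M) = _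
      rw [← max_div_div_right hpos.le, zero_div]

/-- A bound for the Rademacher complexity of the networks with `κ(θ) ≤ K`. -/
lemma signs_eval_le {n : ℕ} (x : Fin n → Fin d → ℝ) (hx : ∀ i, x i ∈ Set.Icc (0 : Fin d → ℝ) 1)
    {K : ℝ} (θ : (Fin n → ℤˣ) → ReLUNet d 1 L) (hθ : ∀ ε, (θ ε).kappa ≤ K) :
    ∑ ε : Fin n → ℤˣ, ∑ i, ((ε i : ℤ) : ℝ) * (θ ε).eval (x i) 0 ≤
      K * (2 ^ L * ((d + 1) * (2 ^ n * √n))) := by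
  have hK : 0 ≤ K := (kappa_nonneg _).trans (hθ 1)
  have hpt : ∀ ε : Fin n → ℤˣ, ∃ g ∈ unitNeurons d L,
      ∑ i, ((ε i : ℤ) : ℝ) * (θ ε).eval (x i) 0 ≤ K * |∑ i, ((ε i : ℤ) : ℝ) * g (x i)| := by
    intro ε
    rcases eq_or_ne (‖(θ ε).out‖) 0 with h0 | h0
    · refine ⟨_, one_mem_unitNeurons d L, ?_⟩
      have : (θ ε).out = 0 := norm_eq_zero.1 h0
      simp only [eval, this, Matrix.zero_mulVec, Pi.zero_apply, mul_zero, Finset.sum_const_zero]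
      positivity
    · have hout : 0 < ‖(θ ε).out‖ := lt_of_le_of_ne (norm_nonneg _) (Ne.symm h0)
      have hP := (zero_lt_one.trans_le ((θ ε).one_le_layerNorms L))
      have hmem : (fun x => (θ ε).eval x 0 / (θ ε).kappa) ∈ absComb (unitNeurons d L) := by
        refine ⟨Fin (layerDim d (θ ε).N L), inferInstance, fun j => (θ ε).out 0 j / ‖(θ ε).out‖,
          fun j x => (θ ε).hidden x L j / (θ ε).layerNorms L,
          (θ ε).hidden_div_mem_unitNeurons L, ?_, ?_⟩
        · simp only [abs_div, abs_norm, ← Finset.sum_div]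
          exact (div_le_one hout).2 (row_sum_le_linfty_norm _ 0)
        · funext x
          rw [kappa_eq]
          simp only [eval, Matrix.mulVec, dotProduct, Finset.sum_div]
          exact Finset.sum_congr rfl fun j _ => by rw [div_mul_div_comm]
      obtain ⟨g, hg, hle⟩ := exists_mem_of_absComb ⟨_, one_mem_unitNeurons d L⟩ hmem x ε
      refine ⟨g, hg, ?_⟩
      have hκ : 0 < (θ ε).kappa := by rw [kappa_eq]; positivity
      have h1 : ∑ i, ((ε i : ℤ) : ℝ) * (θ ε).eval (x i) 0 =
          (θ ε).kappa * ∑ i, ((ε i : ℤ) : ℝ) * ((θ ε).eval (x i) 0 / (θ ε).kappa) := by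
        rw [Finset.mul_sum]
        exact Finset.sum_congr rfl fun i _ => by field_simp
      rw [h1]
      calc _ ≤ (θ ε).kappa * |∑ i, ((ε i : ℤ) : ℝ) * g (x i)| := by
            gcongr
            exact (le_abs_self _).trans hle
        _ ≤ _ := by gcongr; exact hθ ε
  choose g hg hle using hpt
  refine (Finset.sum_le_sum fun ε _ => hle ε).trans ?_
  rw [← Finset.mul_sum]
  exact mul_le_mul_of_nonneg_left (unitNeurons_signs_le d x hx L g hg) hK

lemma continuous_hidden (θ : ReLUNet d k L) (ℓ : ℕ) : Continuous fun x => θ.hidden x ℓ := by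
  induction ℓ with
  | zero => exact continuous_id
  | succ ℓ ih =>
    refine continuous_pi fun i => ?_
    change Continuous fun x => max (((θ.A ℓ).mulVec (θ.hidden x ℓ) + θ.b ℓ) i) 0
    refine Continuous.max ?_ continuous_const
    exact (continuous_apply i).comp ((continuous_const.matrix_mulVec ih).add continuous_const)

lemma continuous_eval (θ : ReLUNet d k L) : Continuous θ.eval :=
  continuous_const.matrix_mulVec (θ.continuous_hidden L)

end ReLUNet

end Norms

/-! ### Symmetrization with a ghost sample. -/

section Symmetrization

/-- If every selection of elements of the index type gives a sum of at most `B`, then the sum of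
the suprema is at most `B`. -/
lemma sum_ciSup_le_of_selection {κ Θ : Type*} [Fintype κ] [Nonempty Θ] (f : κ → Θ → ℝ)
    (B : ℝ) (h : ∀ t : κ → Θ, ∑ k, f k (t k) ≤ B) : ∑ k, ⨆ a, f k a ≤ B := by
  refine le_of_forall_pos_le_add fun δ hδ => ?_
  have hδ' : 0 < δ / (Fintype.card κ + 1) := by positivity
  have hex : ∀ k, ∃ a, (⨆ a, f k a) - δ / (Fintype.card κ + 1) < f k a := fun k =>
    exists_lt_of_lt_ciSup (sub_lt_self _ hδ')
  choose t ht using hex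
  calc ∑ k, ⨆ a, f k a ≤ ∑ k, (f k (t k) + δ / (Fintype.card κ + 1)) :=
        Finset.sum_le_sum fun k _ => by linarith [ht k]
    _ = ∑ k, f k (t k) + Fintype.card κ * (δ / (Fintype.card κ + 1)) := by
        rw [Finset.sum_add_distrib]; simp
    _ ≤ B + δ := by
        gcongr
        · exact h t
        · rw [mul_div_assoc', div_le_iff₀ (by positivity)]
          nlinarith

variable {E : Type*} [MeasurableSpace E]

/-- Exchanging the `i`-th entries of two samples for the indices with `ε i = -1`. -/
def swapSigns {n : ℕ} (ε : Fin n → ℤˣ) (p : (Fin n → E) × (Fin n → E)) :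
    (Fin n → E) × (Fin n → E) :=
  (fun i => if ε i = 1 then p.1 i else p.2 i, fun i => if ε i = 1 then p.2 i else p.1 i)

lemma measurePreserving_swapSigns {n : ℕ} (ε : Fin n → ℤˣ) (μ : Measure E)
    [IsProbabilityMeasure μ] :
    MeasurePreserving (swapSigns ε)
      ((Measure.pi fun _ : Fin n => μ).prod (Measure.pi fun _ : Fin n => μ))
      ((Measure.pi fun _ : Fin n => μ).prod (Measure.pi fun _ : Fin n => μ)) := by
  have h1 := measurePreserving_arrowProdEquivProdArrow E E (Fin n) (fun _ => μ) (fun _ => μ)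
  have h2 : MeasurePreserving (fun (z : Fin n → E × E) i => if ε i = 1 then z i else (z i).swap)
      (Measure.pi fun _ : Fin n => μ.prod μ) (Measure.pi fun _ : Fin n => μ.prod μ) := by
    refine measurePreserving_pi (fun _ => μ.prod μ) (fun _ => μ.prod μ)
      (f := fun i (z : E × E) => if ε i = 1 then z else z.swap) fun i => ?_
    by_cases h : ε i = 1
    · simp only [h, if_true]
      exact MeasurePreserving.id _
    · simp only [h, if_false]
      exact Measure.measurePreserving_swap
  have h3 := (h1.comp h2).comp h1.symm
  convert h3 using 1
  funext p
  refine Prod.ext (funext fun i => ?_) (funext fun i => ?_) <;>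
  · by_cases h : ε i = 1 <;>
    simp [swapSigns, h, MeasurableEquiv.arrowProdEquivProdArrow, Equiv.arrowProdEquivProdArrow]

/-- The symmetrization inequality for a uniformly bounded family of continuous functions. -/
lemma symmetrization [TopologicalSpace E] [SecondCountableTopology E] [BorelSpace E]
    {Θ : Type*} [Nonempty Θ] {n : ℕ} (F : Θ → E → ℝ)
    (hF : ∀ a, Continuous (F a)) {M : ℝ} (hM : ∀ a x, |F a x| ≤ M) (μ : Measure E)
    [IsProbabilityMeasure μ] {S : Set E} (hS : ∀ᵐ x ∂μ, x ∈ S) {R : ℝ}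
    (hR : ∀ x : Fin n → E, (∀ i, x i ∈ S) → ∀ t : (Fin n → ℤˣ) → Θ,
      ∑ ε, ∑ i, ((ε i : ℤ) : ℝ) * F (t ε) (x i) ≤ 2 ^ n * R) :
    let G : (Fin n → E) → ℝ := fun x => ⨆ a, (n * ∫ y, F a y ∂μ - ∑ i, F a (x i))
    (∀ x : Fin n → E, BddAbove (Set.range fun a => n * ∫ y, F a y ∂μ - ∑ i, F a (x i))) ∧
    Integrable G (Measure.pi fun _ => μ) ∧ ∫ x, G x ∂(Measure.pi fun _ => μ) ≤ 2 * R := by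
  intro G
  obtain ⟨a₀⟩ := ‹Nonempty Θ›
  have hint : ∀ a, Integrable (F a) μ := fun a =>
    Integrable.of_bound (hF a).aestronglyMeasurable M (.of_forall (hM a))
  have hmean : ∀ a, |∫ y, F a y ∂μ| ≤ M := by
    intro a
    have := norm_integral_le_of_norm_le_const (μ := μ) (f := F a) (C := M) (.of_forall (hM a))
    simpa using this
  have hsum : ∀ a (x : Fin n → E), |∑ i, F a (x i)| ≤ n * M := by
    intro a x
    refine (Finset.abs_sum_le_sum_abs _ _).trans
      ((Finset.sum_le_sum fun i _ => hM a (x i)).trans (by simp))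
  have hGb : ∀ a (x : Fin n → E), |n * ∫ y, F a y ∂μ - ∑ i, F a (x i)| ≤ 2 * (n * M) := by
    intro a x
    refine (abs_sub _ _).trans ?_
    rw [abs_mul, Nat.abs_cast]
    have := mul_le_mul_of_nonneg_left (hmean a) (Nat.cast_nonneg (α := ℝ) n)
    linarith [hsum a x]
  have hGbdd : ∀ x : Fin n → E, BddAbove (Set.range fun a => n * ∫ y, F a y ∂μ - ∑ i, F a (x i)) := by
    intro x
    refine ⟨2 * (n * M), ?_⟩
    rintro _ ⟨a, rfl⟩
    exact (le_abs_self _).trans (hGb a x)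
  have habs_sup : ∀ (f : Θ → ℝ) (B : ℝ), (∀ a, |f a| ≤ B) → |⨆ a, f a| ≤ B := by
    intro f B hf
    have hb : BddAbove (Set.range f) := ⟨B, by rintro _ ⟨a, rfl⟩; exact (abs_le.1 (hf a)).2⟩
    exact abs_le.2 ⟨(abs_le.1 (hf a₀)).1.trans (le_ciSup hb a₀), ciSup_le fun a => (abs_le.1 (hf a)).2⟩
  -- The supremum may be uncountable; it is measurable because a supremum of continuous functions is
  -- lower semicontinuous.
  have hGmeas : Measurable G := by
    refine LowerSemicontinuous.measurable (lowerSemicontinuous_ciSup hGbdd fun a => ?_)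
    refine Continuous.lowerSemicontinuous ?_
    have := hF a
    fun_prop
  set ν : Measure (Fin n → E) := Measure.pi fun _ => μ with hν
  have hGint : Integrable G ν :=
    Integrable.of_bound hGmeas.aestronglyMeasurable (2 * (n * M))
      (.of_forall fun x => habs_sup _ _ fun a => hGb a x)
  refine ⟨hGbdd, hGint, ?_⟩
  let H : (Fin n → ℤˣ) → (Fin n → E) × (Fin n → E) → ℝ := fun ε p =>
    ⨆ a, ∑ i, ((ε i : ℤ) : ℝ) * (F a (p.2 i) - F a (p.1 i))
  have hHb : ∀ (ε : Fin n → ℤˣ) a (p : (Fin n → E) × (Fin n → E)),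
      |∑ i, ((ε i : ℤ) : ℝ) * (F a (p.2 i) - F a (p.1 i))| ≤ n * (2 * M) := by
    intro ε a p
    refine (Finset.abs_sum_le_sum_abs _ _).trans
      ((Finset.sum_le_sum (g := fun _ => 2 * M) fun i _ => ?_).trans (by simp))
    rw [abs_mul, abs_sign, one_mul]
    exact (abs_sub _ _).trans (by linarith [hM a (p.2 i), hM a (p.1 i)])
  have hHbdd : ∀ (ε : Fin n → ℤˣ) (p : (Fin n → E) × (Fin n → E)), BddAbove (Set.range fun a =>
      ∑ i, ((ε i : ℤ) : ℝ) * (F a (p.2 i) - F a (p.1 i))) := by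
    intro ε p
    refine ⟨n * (2 * M), ?_⟩
    rintro _ ⟨a, rfl⟩
    exact (le_abs_self _).trans (hHb ε a p)
  have hHmeas : ∀ ε, Measurable (H ε) := by
    intro ε
    refine LowerSemicontinuous.measurable (lowerSemicontinuous_ciSup (hHbdd ε) fun a => ?_)
    refine Continuous.lowerSemicontinuous ?_
    have := hF a
    fun_prop
  have hHint : ∀ ε, Integrable (H ε) (ν.prod ν) := fun ε =>
    Integrable.of_bound (hHmeas ε).aestronglyMeasurable (n * (2 * M))
      (.of_forall fun p => habs_sup _ _ fun a => hHb ε a p)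
  -- A sign -1 amounts to exchanging a sample point with its ghost, which preserves the product
  -- measure.
  have hHswap : ∀ ε, ∫ p, H ε p ∂(ν.prod ν) = ∫ p, H 1 p ∂(ν.prod ν) := by
    intro ε
    have hmp := measurePreserving_swapSigns ε μ
    have h1 : ∫ p, H 1 (swapSigns ε p) ∂(ν.prod ν) = ∫ p, H 1 p ∂(ν.prod ν) := by
      conv_rhs => rw [← hmp.map_eq]
      rw [integral_map hmp.measurable.aemeasurable (hHmeas 1).aestronglyMeasurable]
    rw [← h1]
    refine integral_congr_ae (.of_forall fun p => ?_)
    change H ε p = H 1 (swapSigns ε p)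
    refine iSup_congr fun a => Finset.sum_congr rfl fun i _ => ?_
    rcases Int.units_eq_one_or (ε i) with h | h
    · simp [swapSigns, h]
    · have : ((-1 : ℤˣ) = 1) = False := by simp
      simp [swapSigns, h, this]
  -- The mean is an integral over the ghost sample, and a supremum of integrals is at most the
  -- integral of the supremum.
  have hGle : ∀ x, G x ≤ ∫ x', H 1 (x, x') ∂ν := by
    intro x
    refine ciSup_le fun a => ?_
    have hint' : ∀ i, Integrable (fun x' : Fin n → E => F a (x' i)) ν := fun i =>
      Integrable.of_bound ((hF a).comp (continuous_apply i)).measurable.aestronglyMeasurable M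
        (.of_forall fun x' => hM a _)
    have hev : ∀ i, ∫ x' : Fin n → E, F a (x' i) ∂ν = ∫ y, F a y ∂μ := fun i =>
      integral_comp_eval (μ := fun _ : Fin n => μ) (i := i) (hF a).aestronglyMeasurable
    have hd : ∀ i, Integrable (fun x' : Fin n → E => F a (x' i) - F a (x i)) ν :=
      fun i => (hint' i).sub (integrable_const _)
    have h1 : n * ∫ y, F a y ∂μ - ∑ i, F a (x i) =
        ∫ x', ∑ i, (((1 : Fin n → ℤˣ) i : ℤ) : ℝ) * (F a (x' i) - F a (x i)) ∂ν := by
      simp only [Pi.one_apply, Units.val_one, Int.cast_one, one_mul]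
      rw [integral_finsetSum _ fun i _ => hd i]
      have : ∀ i, ∫ x' : Fin n → E, (F a (x' i) - F a (x i)) ∂ν = ∫ y, F a y ∂μ - F a (x i) := by
        intro i
        rw [integral_sub (hint' i) (integrable_const _), hev]
        simp
      simp [this]
    rw [h1]
    refine integral_mono ?_ ?_ fun x' => le_ciSup (hHbdd 1 (x, x')) a
    · simp only [Pi.one_apply, Units.val_one, Int.cast_one, one_mul]
      exact integrable_finsetSum _ fun i _ => hd i
    · exact Integrable.of_bound
        ((hHmeas 1).comp measurable_prodMk_left).aestronglyMeasurable (n * (2 * M))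
        (.of_forall fun x' => habs_sup _ _ fun a => hHb 1 a (x, x'))
  have hstep : ∫ x, G x ∂ν ≤ ∫ p, H 1 p ∂(ν.prod ν) := by
    rw [integral_prod _ (hHint 1)]
    exact integral_mono hGint (hHint 1).integral_prod_left hGle
  have hSn : ∀ᵐ x ∂ν, ∀ i, x i ∈ S := by
    rw [ae_all_iff]
    intro i
    exact (measurePreserving_eval (fun _ : Fin n => μ) i).quasiMeasurePreserving.ae hS
  have hpair : ∀ᵐ p ∂(ν.prod ν), (∀ i, p.1 i ∈ S) ∧ ∀ i, p.2 i ∈ S :=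
    (Measure.quasiMeasurePreserving_fst.ae hSn).and (Measure.quasiMeasurePreserving_snd.ae hSn)
  -- Sample and ghost sample are bounded separately by `hR`; for the one entering with a minus sign,
  -- the selection is taken at -ε.
  have hsumle : ∀ p : (Fin n → E) × (Fin n → E), (∀ i, p.1 i ∈ S) ∧ (∀ i, p.2 i ∈ S) →
      ∑ ε, H ε p ≤ 2 ^ n * R + 2 ^ n * R := by
    rintro p ⟨hp1, hp2⟩
    have : Nonempty Θ := ⟨a₀⟩
    refine sum_ciSup_le_of_selection _ _ fun t => ?_
    have h1 := hR p.2 hp2 t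
    have h2 := hR p.1 hp1 fun ε => t (-ε)
    rw [← Equiv.sum_comp (Equiv.neg _)] at h2
    refine le_of_eq_of_le ?_ (add_le_add h1 h2)
    rw [← Finset.sum_add_distrib]
    refine Finset.sum_congr rfl fun ε _ => ?_
    rw [← Finset.sum_add_distrib]
    refine Finset.sum_congr rfl fun i _ => ?_
    simp only [Equiv.neg_apply, neg_neg, Pi.neg_apply, Units.val_neg, Int.cast_neg]
    ring
  have htotal : (2 : ℝ) ^ n * ∫ p, H 1 p ∂(ν.prod ν) ≤ 2 ^ n * R + 2 ^ n * R := by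
    have h1 : ∫ p, ∑ ε, H ε p ∂(ν.prod ν) = 2 ^ n * ∫ p, H 1 p ∂(ν.prod ν) := by
      rw [integral_finsetSum _ fun ε _ => hHint ε]
      simp only [hHswap, Finset.sum_const, Finset.card_univ, card_signs, Fintype.card_fin,
        nsmul_eq_mul]
      push_cast
      rfl
    rw [← h1]
    have h2 := integral_mono_ae (integrable_finsetSum _ fun ε _ => hHint ε)
      (integrable_const (μ := ν.prod ν) (2 ^ n * R + 2 ^ n * R)) (hpair.mono hsumle)
    simpa using h2
  have h2n : (0 : ℝ) < 2 ^ n := by positivity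
  have : (2 : ℝ) ^ n * ∫ p, H 1 p ∂(ν.prod ν) ≤ 2 ^ n * (2 * R) := by linarith
  exact hstep.trans (le_of_mul_le_mul_left this h2n)

end Symmetrization

/-! ### Uniform deviation of the square loss. -/

section Generalization

/-- Uniform deviation of the empirical from the expected square loss over networks with values in
`[-1, 1]` and `κ(θ) ≤ K`, in expectation, in the absence of noise. -/
lemma uniform_deviation {d W L n : ℕ} {K : ℝ} (hn : 0 < n)
    (g : (Fin d → ℝ) → ℝ) (hg : Continuous g) (hg1 : ∀ x, |g x| ≤ 1)
    (μ : Measure (Fin d → ℝ)) [IsProbabilityMeasure μ] (hμ : μ (Set.Icc 0 1)ᶜ = 0)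
    (hne : ∃ θ ∈ ReLUNet.boundedClass d 1 W L 1, θ.kappa ≤ K) :
    ∃ G : (Fin n → Fin d → ℝ) → ℝ, Integrable G (Measure.pi fun _ => μ) ∧
      ∫ x, G x ∂(Measure.pi fun _ => μ) ≤ 8 * (K * (2 ^ L * (d + 1))) / √n ∧
      ∀ θ ∈ ReLUNet.boundedClass d 1 W L 1, θ.kappa ≤ K → ∀ x : Fin n → Fin d → ℝ,
        ∫ y, (θ.eval y 0 - g y) ^ 2 ∂μ ≤
          (1 / (n : ℝ)) * ∑ i, (θ.eval (x i) 0 - g (x i)) ^ 2 + G x := by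
  set Θ := {θ : ReLUNet d 1 L // θ ∈ ReLUNet.boundedClass d 1 W L 1 ∧ θ.kappa ≤ K} with hΘ
  obtain ⟨θ₀, h₀, hκ₀⟩ := hne
  have : Nonempty Θ := ⟨⟨θ₀, h₀, hκ₀⟩⟩
  let F : Θ → (Fin d → ℝ) → ℝ := fun θ x => (θ.1.eval x 0 - g x) ^ 2
  have hdiff : ∀ (θ : Θ) x, |θ.1.eval x 0 - g x| ≤ 2 := by
    intro θ x
    have h1 := θ.2.1.2 x 0
    have h2 := abs_le.1 (hg1 x)
    rw [abs_le]
    constructor <;> linarith [h1.1, h1.2]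
  have hFc : ∀ θ, Continuous (F θ) := fun θ =>
    (((continuous_apply 0).comp θ.1.continuous_eval).sub hg).pow 2
  have hFb : ∀ θ x, |F θ x| ≤ 4 := by
    intro θ x
    have := hdiff θ x
    have h0 := abs_nonneg (θ.1.eval x 0 - g x)
    simp only [F, abs_pow]
    nlinarith
  set R₀ : ℝ := K * (2 ^ L * ((d + 1) * √n)) with hR₀
  have hR : ∀ x : Fin n → Fin d → ℝ, (∀ i, x i ∈ Set.Icc (0 : Fin d → ℝ) 1) →
      ∀ t : (Fin n → ℤˣ) → Θ,
      ∑ ε, ∑ i, ((ε i : ℤ) : ℝ) * F (t ε) (x i) ≤ 2 ^ n * (4 * R₀) := by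
    intro x hx
    -- The residuals lie in [-2, 2], where squaring is 4-Lipschitz.
    refine contraction_signs (fun θ i => F θ (x i))
      (fun (θ : Θ) i => 4 * (θ.1.eval (x i) 0 - g (x i))) ?_ _ ?_
    · intro i k l
      have hk := hdiff k (x i)
      have hl := hdiff l (x i)
      have : F k (x i) - F l (x i) = ((k.1.eval (x i) 0 - g (x i)) + (l.1.eval (x i) 0 - g (x i))) *
          ((k.1.eval (x i) 0 - g (x i)) - (l.1.eval (x i) 0 - g (x i))) := by
        simp only [F]; ring
      rw [this, abs_mul, ← mul_sub, abs_mul, abs_of_pos (by norm_num : (0 : ℝ) < 4)]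
      gcongr
      exact (abs_add_le _ _).trans (by linarith)
    · intro t
      have h1 := ReLUNet.signs_eval_le x hx (fun ε => (t ε).1) (fun ε => (t ε).2.2)
      -- The target does not depend on the selected network, so its signed sums cancel over ε.
      have h2 : ∑ ε : Fin n → ℤˣ, ∑ i, ((ε i : ℤ) : ℝ) * g (x i) = 0 := by
        rw [Finset.sum_comm]
        refine Finset.sum_eq_zero fun i _ => sum_signs_eq_zero i _ fun ε => ?_
        rw [flipSign_same]
        simp
      have h3 : ∑ ε : Fin n → ℤˣ, ∑ i,
          ((ε i : ℤ) : ℝ) * (4 * ((t ε).1.eval (x i) 0 - g (x i))) =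
          4 * (∑ ε : Fin n → ℤˣ, ∑ i, ((ε i : ℤ) : ℝ) * (t ε).1.eval (x i) 0) -
            4 * ∑ ε : Fin n → ℤˣ, ∑ i, ((ε i : ℤ) : ℝ) * g (x i) := by
        rw [Finset.mul_sum, Finset.mul_sum, ← Finset.sum_sub_distrib]
        refine Finset.sum_congr rfl fun ε _ => ?_
        rw [Finset.mul_sum, Finset.mul_sum, ← Finset.sum_sub_distrib]
        exact Finset.sum_congr rfl fun i _ => by ring
      rw [h3, h2, mul_zero, sub_zero, hR₀]
      calc _ ≤ 4 * (K * (2 ^ L * ((d + 1) * (2 ^ n * √n)))) := by gcongr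
        _ = _ := by ring
  have hS : ∀ᵐ x ∂μ, x ∈ Set.Icc (0 : Fin d → ℝ) 1 := by
    rw [ae_iff]
    exact hμ
  obtain ⟨hbdd, hGi, hGle⟩ := symmetrization F hFc hFb μ hS hR
  have hn' : (0 : ℝ) < n := by exact_mod_cast hn
  refine ⟨fun x => (1 / (n : ℝ)) * ⨆ a, (n * ∫ y, F a y ∂μ - ∑ i, F a (x i)),
    hGi.const_mul _, ?_, ?_⟩
  · rw [integral_const_mul]
    calc _ ≤ (1 / (n : ℝ)) * (2 * (4 * R₀)) := by gcongr
      _ = _ := by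
        rw [hR₀]
        have hs : √(n : ℝ) * √n = n := Real.mul_self_sqrt hn'.le
        have hs0 : 0 < √(n : ℝ) := Real.sqrt_pos.2 hn'
        field_simp
        rw [sq, hs]
        ring
  · intro θ hθ hκ x
    have h1 := le_ciSup (hbdd x) (⟨θ, hθ, hκ⟩ : Θ)
    simp only [F] at h1 ⊢
    rw [← mul_add, one_div, ← div_eq_inv_mul, le_div_iff₀ hn']
    linarith

end Generalization

/-! ### Approximate multiplication by rectified linear functions. -/

section Product

/-- Piecewise linear interpolation at `k + 1` equidistant knots in `[-a, a]`, written as a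
combination of rectified linear functions. -/
lemma exists_relu_interpolation {a M : ℝ} (ha : 0 < a) (p p' : ℝ → ℝ)
    (hp : ∀ t, HasDerivAt p (p' t) t) (hM : ∀ t, |t| ≤ a → |p' t| ≤ M)
    (hL : ∀ s t, |s| ≤ a → |t| ≤ a → |p' s - p' t| ≤ M * |s - t|) {k : ℕ} (hk : 0 < k) :
    ∃ c τ : Fin k → ℝ, (∀ j, |τ j| ≤ a) ∧ ∑ j, |c j| ≤ M + 4 * a * M ∧
      ∀ t, |t| ≤ a → |p t - p (-a) - ∑ j, c j * max (t - τ j) 0| ≤ M * (2 * a / k) ^ 2 := by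
  have hk' : (0 : ℝ) < k := by exact_mod_cast hk
  set h : ℝ := 2 * a / k with hh
  have hh0 : 0 < h := by positivity
  have hkh : k * h = 2 * a := by rw [hh]; field_simp
  have hM0 : 0 ≤ M := (abs_nonneg _).trans (hM 0 (by simpa using ha.le))
  let T : ℕ → ℝ := fun j => -a + j * h
  have hTsucc : ∀ j, T (j + 1) = T j + h := fun j => by simp only [T]; push_cast; ring
  have hTmem : ∀ j, j ≤ k → -a ≤ T j ∧ T j ≤ a := by
    intro j hj
    have h1 : (j : ℝ) * h ≤ k * h := by gcongr
    have h2 : 0 ≤ (j : ℝ) * h := by positivity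
    constructor <;> simp only [T] <;> linarith
  let s : ℕ → ℝ := fun j => (p (T (j + 1)) - p (T j)) / h
  have hslope : ∀ j, j < k → ∃ ξ, T j ≤ ξ ∧ ξ ≤ T (j + 1) ∧ |ξ| ≤ a ∧ p' ξ = s j := by
    intro j hj
    have hlt : T j < T (j + 1) := by rw [hTsucc]; linarith
    obtain ⟨ξ, hξ, hξ'⟩ := exists_hasDerivAt_eq_slope p p' hlt
      (fun t _ => (hp t).continuousAt.continuousWithinAt) (fun t _ => hp t)
    have h1 := (hTmem j hj.le).1
    have h2 := (hTmem (j + 1) hj).2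
    refine ⟨ξ, hξ.1.le, hξ.2.le, abs_le.2 ⟨h1.trans hξ.1.le, hξ.2.le.trans h2⟩, ?_⟩
    rw [hξ']
    simp only [s]
    rw [hTsucc]
    congr 1
    ring
  -- Coefficients are the jumps of the chord slopes, so partial sums telescope to chords. Slopes are
  -- values of `p'`: the first is at most `M`, later jumps at most `2 * h * M`, in total at most `M
  -- + 4 * a * M`.
  let c : ℕ → ℝ := fun j => if j = 0 then s 0 else s j - s (j - 1)
  have hsum : ∀ m t, ∑ j ∈ Finset.range (m + 1), c j * (t - T j) =
      p (T m) - p (-a) + s m * (t - T m) := by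
    intro m t
    induction m with
    | zero => simp [c, T]
    | succ m ih =>
      rw [Finset.sum_range_succ, ih]
      have h1 : p (T (m + 1)) = p (T m) + s m * h := by
        simp only [s]; field_simp; ring
      simp only [c, Nat.succ_ne_zero, if_false, Nat.add_sub_cancel]
      rw [h1, hTsucc]
      ring
  have hc0 : |c 0| ≤ M := by
    obtain ⟨ξ, -, -, h3, h4⟩ := hslope 0 hk
    simp only [c, if_true, ← h4]
    exact hM ξ h3
  have hc : ∀ j, j + 1 < k → |c (j + 1)| ≤ M * (2 * h) := by
    intro j hj
    obtain ⟨ξ, h1, h2, h3, h4⟩ := hslope j (by omega)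
    obtain ⟨η, h1', h2', h3', h4'⟩ := hslope (j + 1) hj
    simp only [c, Nat.succ_ne_zero, if_false, Nat.add_sub_cancel, ← h4, ← h4']
    refine (hL η ξ h3' h3).trans (mul_le_mul_of_nonneg_left ?_ hM0)
    rw [hTsucc] at *
    rw [hTsucc] at *
    rw [abs_le]
    constructor <;> linarith
  refine ⟨fun j => c j, fun j => T j, fun j => abs_le.2 (hTmem j j.2.le), ?_, ?_⟩
  · rw [← Finset.sum_range (fun j => |c j|)]
    obtain ⟨k, rfl⟩ : ∃ k', k = k' + 1 := ⟨k - 1, by omega⟩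
    rw [Finset.sum_range_succ']
    have : ∑ j ∈ Finset.range k, |c (j + 1)| ≤ ∑ _j ∈ Finset.range k, M * (2 * h) :=
      Finset.sum_le_sum fun j hj => hc j (by have := Finset.mem_range.1 hj; omega)
    simp only [Finset.sum_const, Finset.card_range, nsmul_eq_mul] at this
    have h2 : (k : ℝ) * (M * (2 * h)) ≤ 4 * a * M := by
      have : (k : ℝ) * h ≤ 2 * a := by
        rw [← hkh]; push_cast; nlinarith
      nlinarith
    linarith
  · intro t ht
    rw [abs_le] at ht
    -- Index of an interval containing `t`; the minimum assigns the right endpoint `t = a` to the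
    -- last interval.
    set m : ℕ := min ⌊(t + a) / h⌋₊ (k - 1) with hm
    have hmk : m < k := lt_of_le_of_lt (min_le_right _ _) (by omega)
    have hta : 0 ≤ (t + a) / h := div_nonneg (by linarith) hh0.le
    have h1 : T m ≤ t := by
      have : (m : ℝ) ≤ (t + a) / h :=
        (Nat.cast_le.2 (min_le_left _ _)).trans (Nat.floor_le hta)
      rw [le_div_iff₀ hh0] at this
      simp only [T]; linarith
    have h2 : t ≤ T (m + 1) := by
      rcases le_total ⌊(t + a) / h⌋₊ (k - 1) with hle | hle
      · have hm' : m = ⌊(t + a) / h⌋₊ := min_eq_left hle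
        have := (Nat.lt_floor_add_one ((t + a) / h)).le
        rw [← hm', div_le_iff₀ hh0] at this
        simp only [T]; push_cast; linarith
      · have hm' : m + 1 = k := by rw [hm, min_eq_right hle]; omega
        rw [hm']
        simp only [T]; linarith
    have hTmono : Monotone T := fun i j hij => by
      simp only [T]; gcongr
    have hrelu : ∑ j : Fin k, c j * max (t - T j) 0 =
        ∑ j ∈ Finset.range (m + 1), c j * (t - T j) := by
      rw [← Finset.sum_range (fun j => c j * max (t - T j) 0)]
      symm
      rw [← Finset.sum_subset (Finset.range_mono (by omega : m + 1 ≤ k))]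
      · refine Finset.sum_congr rfl fun j hj => ?_
        have := hTmono (Nat.lt_succ_iff.1 (Finset.mem_range.1 hj))
        rw [max_eq_left (by linarith)]
      · intro j _ hj
        have := hTmono (by simpa using hj : m + 1 ≤ j)
        rw [max_eq_right (by linarith), mul_zero]
    rw [hrelu, hsum]
    obtain ⟨ξ, hξ1, hξ2, hξ3, hξ4⟩ := hslope m hmk
    have hlast : |p t - (p (T m) + s m * (t - T m))| ≤ M * h ^ 2 := by
      rcases eq_or_lt_of_le h1 with heq | hlt
      · rw [← heq]; simp; positivity
      · obtain ⟨η, hη, hη'⟩ := exists_hasDerivAt_eq_slope p p' hlt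
          (fun t _ => (hp t).continuousAt.continuousWithinAt) (fun t _ => hp t)
        have hηa : |η| ≤ a :=
          abs_le.2 ⟨(hTmem m hmk.le).1.trans hη.1.le, hη.2.le.trans ht.2⟩
        have hpt : p t = p (T m) + p' η * (t - T m) := by
          rw [hη']
          field_simp [sub_ne_zero.2 hlt.ne']
          ring
        rw [hpt, ← hξ4]
        have : p (T m) + p' η * (t - T m) - (p (T m) + p' ξ * (t - T m)) =
            (p' η - p' ξ) * (t - T m) := by ring
        rw [this, abs_mul, sq, ← mul_assoc]
        rw [hTsucc] at h2 hξ2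
        gcongr
        · refine (hL η ξ hηa hξ3).trans (mul_le_mul_of_nonneg_left ?_ hM0)
          rw [abs_le]
          constructor <;> linarith [hη.1, hη.2]
        · rw [abs_le]
          constructor <;> linarith
    convert hlast using 2
    ring

variable (ι : Type) [Fintype ι] [DecidableEq ι]

lemma prod_flipSign {ι : Type*} [Fintype ι] [DecidableEq ι] (i : ι) (ε : ι → ℤˣ) :
    ∏ j, ((flipSign i ε j : ℤ) : ℝ) = -∏ j, ((ε j : ℤ) : ℝ) := by
  rw [← Finset.mul_prod_erase _ _ (Finset.mem_univ i),
    ← Finset.mul_prod_erase _ (fun i => ((ε i : ℤ) : ℝ)) (Finset.mem_univ i), flipSign_same]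
  have h1 : ∏ j ∈ Finset.univ.erase i, ((flipSign i ε j : ℤ) : ℝ) =
      ∏ j ∈ Finset.univ.erase i, ((ε j : ℤ) : ℝ) :=
    Finset.prod_congr rfl fun j hj => by rw [flipSign_ne (Finset.ne_of_mem_erase hj)]
  rw [h1]
  push_cast
  ring

/-- Polarization: a product of `D` numbers as a combination of `D`-th powers of signed sums. -/
lemma exists_polarization : ∃ c : ℝ, 1 ≤ c ∧ ∀ u : ι → ℝ,
    ∑ ε : ι → ℤˣ, (∏ i, ((ε i : ℤ) : ℝ)) * (∑ i, ((ε i : ℤ) : ℝ) * u i) ^ Fintype.card ι =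
      c * ∏ i, u i := by
  classical
  set D := Fintype.card ι with hD
  -- In the expanded power only words using every index once survive: if an index is missing,
  -- flipping its sign changes only the factor `∏ ε`.
  let Bij : Finset (Fin D → ι) := Finset.univ.filter Function.Bijective
  refine ⟨2 ^ D * Bij.card, ?_, fun u => ?_⟩
  · have h1 : 1 ≤ Bij.card := Finset.card_pos.2
      ⟨(Fintype.equivFin ι).symm, Finset.mem_filter.2
        ⟨Finset.mem_univ _, (Fintype.equivFin ι).symm.bijective⟩⟩
    have h2 : (1 : ℝ) ≤ Bij.card := by exact_mod_cast h1
    have h3 : (1 : ℝ) ≤ 2 ^ D := one_le_pow₀ (by norm_num)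
    nlinarith
  · simp_rw [Fintype.sum_pow, Finset.mul_sum]
    rw [Finset.sum_comm]
    have hterm : ∀ q : Fin D → ι,
        ∑ ε : ι → ℤˣ, (∏ i, ((ε i : ℤ) : ℝ)) * ∏ l, ((ε (q l) : ℤ) : ℝ) * u (q l) =
          if q ∈ Bij then 2 ^ D * ∏ i, u i else 0 := by
      intro q
      split_ifs with hq
      · have hq' : Function.Bijective q := by simpa [Bij] using hq
        have : ∀ ε : ι → ℤˣ,
            (∏ i, ((ε i : ℤ) : ℝ)) * ∏ l, ((ε (q l) : ℤ) : ℝ) * u (q l) = ∏ i, u i := by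
          intro ε
          rw [hq'.prod_comp (fun i => ((ε i : ℤ) : ℝ) * u i), ← Finset.prod_mul_distrib]
          refine Finset.prod_congr rfl fun i _ => ?_
          rw [← mul_assoc, sign_sq, one_mul]
        simp [this, hD]
      · have hns : ¬ Function.Surjective q := fun hs => hq (by
          simp only [Bij, Finset.mem_filter, Finset.mem_univ, true_and]
          exact (Fintype.bijective_iff_surjective_and_card q).2 ⟨hs, by simp [hD]⟩)
        simp only [Function.Surjective, not_forall, not_exists] at hns
        obtain ⟨i, hi⟩ := hns
        refine sum_signs_eq_zero i _ fun ε => ?_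
        have h2 : ∀ l, flipSign i ε (q l) = ε (q l) := fun l => flipSign_ne (hi l) ε
        simp only [prod_flipSign, h2, neg_mul]
    rw [Finset.sum_congr rfl fun q _ => hterm q]
    simp only [Finset.sum_ite_mem, Finset.univ_inter, Finset.sum_const, nsmul_eq_mul]
    ring

/-- Products of numbers in `[-1, 1]` can be approximated with accuracy `O(k⁻²)` by a combination
of rectified signed sums that vanishes exactly as soon as one of the factors vanishes. -/
lemma exists_relu_product [Nonempty ι] : ∃ A : ℝ, 0 < A ∧ ∀ k : ℕ, 0 < k →
    ∃ (w : (ι → ℤˣ) → Fin k → ℝ) (τ : Fin k → ℝ),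
      (∀ j, |τ j| ≤ Fintype.card ι) ∧ (∑ ε, ∑ j, |w ε j| ≤ A) ∧
      (∀ u : ι → ℝ, (∀ i, |u i| ≤ 1) →
        |∏ i, u i - ∑ ε, ∑ j, w ε j * max (∑ i, ((ε i : ℤ) : ℝ) * u i - τ j) 0| ≤
          A / (k : ℝ) ^ 2) ∧
      ∀ u : ι → ℝ, (∃ i, u i = 0) →
        ∑ ε, ∑ j, w ε j * max (∑ i, ((ε i : ℤ) : ℝ) * u i - τ j) 0 = 0 := by
  set D := Fintype.card ι with hD
  have hD0 : 0 < D := Fintype.card_pos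
  have hDr : (0 : ℝ) < D := by exact_mod_cast hD0
  -- On [-D, D], where the signed sums live, this bounds both the derivative of `t ^ D` and the
  -- Lipschitz constant of that derivative.
  set M : ℝ := D * ((D - 1 : ℕ) * (D : ℝ) ^ (D - 1 - 1)) + D * (D : ℝ) ^ (D - 1) with hM
  have hM0 : 0 < M := by positivity
  obtain ⟨c, hc1, hc⟩ := exists_polarization ι
  have hprodabs : ∀ ε : ι → ℤˣ, |∏ i, ((ε i : ℤ) : ℝ)| = 1 := by
    intro ε
    rw [Finset.abs_prod]
    exact Finset.prod_eq_one fun i _ => abs_sign _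
  refine ⟨2 ^ D * (M + 4 * D * M) + 2 ^ D * (M * (2 * D) ^ 2), by positivity, fun k hk => ?_⟩
  have hk' : (0 : ℝ) < k := by exact_mod_cast hk
  obtain ⟨b, τ, hτ, hb, happ⟩ := exists_relu_interpolation (a := D) (M := M) hDr
    (fun t => t ^ D) (fun t => D * t ^ (D - 1)) (fun t => hasDerivAt_pow D t)
    (fun t ht => by
      rw [abs_mul, abs_pow, Nat.abs_cast]
      have : |t| ^ (D - 1) ≤ (D : ℝ) ^ (D - 1) := by gcongr
      have h2 : (0 : ℝ) ≤ D * ((D - 1 : ℕ) * (D : ℝ) ^ (D - 1 - 1)) := by positivity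
      nlinarith)
    (fun s t hs ht => by
      rw [← mul_sub, abs_mul, Nat.abs_cast]
      have h1 := abs_pow_sub_pow_le s t (D - 1)
      have h2 : max |s| |t| ^ (D - 1 - 1) ≤ (D : ℝ) ^ (D - 1 - 1) := by
        gcongr
        exact max_le hs ht
      calc (D : ℝ) * |s ^ (D - 1) - t ^ (D - 1)|
          ≤ D * (|s - t| * (D - 1 : ℕ) * (D : ℝ) ^ (D - 1 - 1)) := by
            gcongr
            exact h1.trans (by gcongr)
        _ = D * ((D - 1 : ℕ) * (D : ℝ) ^ (D - 1 - 1)) * |s - t| := by ring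
        _ ≤ M * |s - t| := by
            gcongr
            rw [hM]
            have : (0 : ℝ) ≤ D * (D : ℝ) ^ (D - 1) := by positivity
            linarith) hk
  refine ⟨fun ε j => (∏ i, ((ε i : ℤ) : ℝ)) / c * b j, τ, hτ, ?_, ?_, ?_⟩
  · have h1 : ∀ ε : ι → ℤˣ, ∑ j, |(∏ i, ((ε i : ℤ) : ℝ)) / c * b j| ≤ M + 4 * D * M := by
      intro ε
      refine le_trans (Finset.sum_le_sum fun j _ => ?_) hb
      rw [abs_mul, abs_div, hprodabs, abs_of_pos (by linarith : 0 < c)]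
      have : 1 / c ≤ 1 := (div_le_one (by linarith)).2 hc1
      exact mul_le_of_le_one_left (abs_nonneg _) this
    refine (Finset.sum_le_sum fun ε _ => h1 ε).trans ?_
    simp only [Finset.sum_const, Finset.card_univ, card_signs, nsmul_eq_mul, ← hD]
    push_cast
    have : (0 : ℝ) ≤ 2 ^ D * (M * (2 * D) ^ 2) := by positivity
    linarith
  · intro u hu
    -- Hence the constant `(-D) ^ D` left by the interpolation drops out, and no bias is needed.
    have hsigns : ∑ ε : ι → ℤˣ, ∏ i, ((ε i : ℤ) : ℝ) = 0 := by
      obtain ⟨i⟩ := ‹Nonempty ι›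
      refine sum_signs_eq_zero i _ fun ε => ?_
      exact prod_flipSign i ε
    have hprod : ∏ i, u i = ∑ ε : ι → ℤˣ, (∏ i, ((ε i : ℤ) : ℝ)) / c *
        ((∑ i, ((ε i : ℤ) : ℝ) * u i) ^ D - (-(D : ℝ)) ^ D) := by
      have h1 : ∑ ε : ι → ℤˣ, (∏ i, ((ε i : ℤ) : ℝ)) / c *
          ((∑ i, ((ε i : ℤ) : ℝ) * u i) ^ D - (-(D : ℝ)) ^ D) =
          (∑ ε : ι → ℤˣ, (∏ i, ((ε i : ℤ) : ℝ)) * (∑ i, ((ε i : ℤ) : ℝ) * u i) ^ D) / c -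
          (∑ ε : ι → ℤˣ, ∏ i, ((ε i : ℤ) : ℝ)) * ((-(D : ℝ)) ^ D / c) := by
        rw [Finset.sum_div, Finset.sum_mul, ← Finset.sum_sub_distrib]
        exact Finset.sum_congr rfl fun ε _ => by ring
      rw [h1, hc u, hsigns]
      have : c ≠ 0 := by linarith
      field_simp
      ring
    rw [hprod, ← Finset.sum_sub_distrib]
    have hle : ∀ ε : ι → ℤˣ, |(∏ i, ((ε i : ℤ) : ℝ)) / c *
        ((∑ i, ((ε i : ℤ) : ℝ) * u i) ^ D - (-(D : ℝ)) ^ D) -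
        ∑ j, (∏ i, ((ε i : ℤ) : ℝ)) / c * b j * max (∑ i, ((ε i : ℤ) : ℝ) * u i - τ j) 0| ≤
        M * (2 * D / k) ^ 2 := by
      intro ε
      have habs : |∑ i, ((ε i : ℤ) : ℝ) * u i| ≤ D := by
        refine (Finset.abs_sum_le_sum_abs _ _).trans ?_
        calc ∑ i, |((ε i : ℤ) : ℝ) * u i| ≤ ∑ _i : ι, (1 : ℝ) :=
              Finset.sum_le_sum fun i _ => by rw [abs_mul, abs_sign, one_mul]; exact hu i
          _ = D := by simp [hD]
      have h1 := happ _ habs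
      simp_rw [mul_assoc, ← Finset.mul_sum]
      rw [← mul_sub, abs_mul, abs_div, hprodabs, abs_of_pos (by linarith : 0 < c)]
      have h2 : 1 / c ≤ 1 := (div_le_one (by linarith)).2 hc1
      exact (mul_le_of_le_one_left (abs_nonneg _) h2).trans h1
    refine (Finset.abs_sum_le_sum_abs _ _).trans ((Finset.sum_le_sum fun ε _ => hle ε).trans ?_)
    simp only [Finset.sum_const, Finset.card_univ, card_signs, nsmul_eq_mul, ← hD]
    push_cast
    rw [div_pow, add_div]
    have : (0 : ℝ) ≤ 2 ^ D * (M + 4 * D * M) / k ^ 2 := by positivity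
    have h3 : (2 : ℝ) ^ D * (M * ((2 * D) ^ 2 / k ^ 2)) = 2 ^ D * (M * (2 * D) ^ 2) / k ^ 2 := by
      ring
    linarith
  · rintro u ⟨i, hi⟩
    -- If `u i = 0`, flipping the sign at `i` keeps every ReLU argument and reverses every weight.
    refine sum_signs_eq_zero i _ fun ε => ?_
    have h2 : ∑ j, ((flipSign i ε j : ℤ) : ℝ) * u j = ∑ j, ((ε j : ℤ) : ℝ) * u j := by
      refine Finset.sum_congr rfl fun j _ => ?_
      by_cases h : j = i
      · rw [h, hi]; simp
      · rw [flipSign_ne h]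
    simp only [prod_flipSign, h2]
    rw [← Finset.sum_neg_distrib]
    exact Finset.sum_congr rfl fun j _ => by ring

end Product

/-! ### Taylor's formula in Hölder classes. -/

section Taylor

variable {d : ℕ}

/-- Summing over index words instead of multi-indices avoids multinomial coefficients: the Taylor
terms need only `1 / j!`. -/
lemma iteratedFDeriv_const_apply_eq_sum (f : (Fin d → ℝ) → ℝ) (j : ℕ) (y v : Fin d → ℝ) :
    iteratedFDeriv ℝ j f y (fun _ => v) =
      ∑ s : Fin j → Fin d, mixedPartial s f y * ∏ m, v (s m) := by
  have hv : (fun _ : Fin j => v) = fun _ => ∑ i, v i • (Pi.single i 1 : Fin d → ℝ) := by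
    funext _
    exact pi_eq_sum_univ' v
  rw [hv, ContinuousMultilinearMap.map_sum]
  refine Finset.sum_congr rfl fun s _ => ?_
  rw [ContinuousMultilinearMap.map_smul_univ, smul_eq_mul, mul_comm]
  rfl

lemma iteratedDeriv_line {f : (Fin d → ℝ) → ℝ} {r : ℕ} (hf : ContDiff ℝ r f) {j : ℕ} (hj : j ≤ r)
    (y v : Fin d → ℝ) (t : ℝ) :
    iteratedDeriv j (fun t : ℝ => f (y + t • v)) t =
      ∑ s : Fin j → Fin d, mixedPartial s f (y + t • v) * ∏ m, v (s m) := by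
  rw [← iteratedFDeriv_const_apply_eq_sum, iteratedDeriv_eq_iteratedFDeriv]
  have hcomp : (fun t : ℝ => f (y + t • v)) =
      (fun z => f (y + z)) ∘ (ContinuousLinearMap.toSpanSingleton ℝ v) := by
    funext t
    simp [ContinuousLinearMap.toSpanSingleton_apply]
  have hf' : ContDiff ℝ r fun z => f (y + z) := hf.comp (contDiff_const.add contDiff_id)
  rw [hcomp, ContinuousLinearMap.iteratedFDeriv_comp_right _ hf' t (by exact_mod_cast hj),
    iteratedFDeriv_comp_add_left]
  simp [ContinuousLinearMap.toSpanSingleton_apply]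

/-- The Taylor polynomial of `f` at `y` of degree `r`, evaluated at `x`. -/
def taylorPoly (f : (Fin d → ℝ) → ℝ) (r : ℕ) (y x : Fin d → ℝ) : ℝ :=
  ∑ j ∈ Finset.range (r + 1), ∑ s : Fin j → Fin d,
    mixedPartial s f y / (j.factorial : ℝ) * ∏ m, (x (s m) - y (s m))

lemma mixedPartial_zero (f : (Fin d → ℝ) → ℝ) (s : Fin 0 → Fin d) (x : Fin d → ℝ) :
    mixedPartial s f x = f x := by
  simp [mixedPartial]

/-- Only `r` derivatives exist, so for positive `r` Lagrange's remainder is taken on the segment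
from `y` to `x` with a polynomial of degree `r - 1`. Subtracting the terms of degree `r` leaves
differences of top derivatives, controlled by the Hölder condition; `d ^ r` counts the index words.
-/
lemma abs_sub_taylorPoly_le {r : ℕ} {β : ℝ} (hβ : 0 < β) {f : (Fin d → ℝ) → ℝ}
    (hf : f ∈ HolderClass d r β) (x y : Fin d → ℝ) :
    |f x - taylorPoly f r y x| ≤ d ^ r * ‖x - y‖ ^ r * ‖x - y‖ ^ β := by
  obtain ⟨hsmooth, -, hholder⟩ := hf
  rcases r with - | r
  · have := hholder Fin.elim0 x y
    simpa [taylorPoly, mixedPartial_zero] using this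
  · set v := x - y with hv
    let G : ℝ → ℝ := fun t => f (y + t • v)
    have hG : ContDiff ℝ (r + 1 : ℕ) G :=
      hsmooth.comp (contDiff_const.add (contDiff_id.smul contDiff_const))
    obtain ⟨ξ, hξ, hrem⟩ := taylor_mean_remainder_lagrange_iteratedDeriv (f := G) (x := 1)
      (x₀ := 0) (n := r) zero_ne_one (by exact_mod_cast hG.contDiffOn)
    rw [Set.uIoo_of_le zero_le_one] at hξ
    have hT : taylorWithinEval G r (Set.uIcc 0 1) 0 1 =
        ∑ j ∈ Finset.range (r + 1), ∑ s : Fin j → Fin d,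
          mixedPartial s f y / (j.factorial : ℝ) * ∏ m, (x (s m) - y (s m)) := by
      rw [taylor_within_apply]
      refine Finset.sum_congr rfl fun j hj => ?_
      have hj' : j ≤ r + 1 := by have := Finset.mem_range.1 hj; omega
      rw [iteratedDerivWithin_eq_iteratedDeriv (uniqueDiffOn_uIcc zero_ne_one)
        ((hG.of_le (by exact_mod_cast hj')).contDiffAt) (by simp)]
      rw [iteratedDeriv_line hsmooth hj']
      simp only [sub_zero, one_pow, mul_one, zero_smul, add_zero, smul_eq_mul, Finset.mul_sum, hv,
        Pi.sub_apply]
      refine Finset.sum_congr rfl fun s _ => ?_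
      ring
    have hG1 : G 1 = f x := by simp [G, hv]
    rw [hT, hG1, iteratedDeriv_line hsmooth le_rfl] at hrem
    have hdiff : f x - taylorPoly f (r + 1) y x = ∑ s : Fin (r + 1) → Fin d,
        (mixedPartial s f (y + ξ • v) - mixedPartial s f y) * (∏ m, v (s m)) /
          ((r + 1).factorial : ℝ) := by
      have : f x - taylorPoly f (r + 1) y x =
          (f x - ∑ j ∈ Finset.range (r + 1), ∑ s : Fin j → Fin d,
            mixedPartial s f y / (j.factorial : ℝ) * ∏ m, (x (s m) - y (s m))) -
          ∑ s : Fin (r + 1) → Fin d,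
            mixedPartial s f y / ((r + 1).factorial : ℝ) * ∏ m, (x (s m) - y (s m)) := by
        rw [taylorPoly, Finset.sum_range_succ]
        ring
      rw [this, hrem, Finset.sum_mul, Finset.sum_div, ← Finset.sum_sub_distrib]
      refine Finset.sum_congr rfl fun s _ => ?_
      simp only [hv, Pi.sub_apply]
      ring
    rw [hdiff]
    have hterm : ∀ s : Fin (r + 1) → Fin d,
        |(mixedPartial s f (y + ξ • v) - mixedPartial s f y) * (∏ m, v (s m)) /
          ((r + 1).factorial : ℝ)| ≤ ‖v‖ ^ (r + 1) * ‖v‖ ^ β := by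
      intro s
      have h1 : |mixedPartial s f (y + ξ • v) - mixedPartial s f y| ≤ ‖v‖ ^ β := by
        refine (hholder s _ _).trans ?_
        refine Real.rpow_le_rpow (norm_nonneg _) ?_ hβ.le
        rw [add_sub_cancel_left, norm_smul, Real.norm_eq_abs, abs_of_pos hξ.1]
        exact mul_le_of_le_one_left (norm_nonneg _) hξ.2.le
      have h2 : |∏ m, v (s m)| ≤ ‖v‖ ^ (r + 1) := by
        rw [Finset.abs_prod]
        refine (Finset.prod_le_prod (fun _ _ => abs_nonneg _) fun m _ => norm_le_pi_norm v (s m)).trans ?_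
        simp
      have h3 : (1 : ℝ) ≤ ((r + 1).factorial : ℝ) := by exact_mod_cast Nat.one_le_iff_ne_zero.2 (Nat.factorial_ne_zero _)
      rw [abs_div, abs_mul, Nat.abs_cast, div_le_iff₀ (by linarith)]
      have h4 : (0 : ℝ) ≤ ‖v‖ ^ (r + 1) * ‖v‖ ^ β := by positivity
      calc _ ≤ ‖v‖ ^ β * ‖v‖ ^ (r + 1) := by gcongr
        _ = ‖v‖ ^ (r + 1) * ‖v‖ ^ β := mul_comm _ _
        _ ≤ _ := le_mul_of_one_le_right h4 h3
    refine (Finset.abs_sum_le_sum_abs _ _).trans ((Finset.sum_le_sum fun s _ => hterm s).trans ?_)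
    simp [mul_assoc]

end Taylor

/-! ### Hat functions as a partition of unity. -/

section Hat

/-- The hat function supported on `[-1, 1]`. -/
def hat (t : ℝ) : ℝ := max (t + 1) 0 - 2 * max t 0 + max (t - 1) 0

lemma hat_nonneg (t : ℝ) : 0 ≤ hat t := by
  unfold hat
  rcases max_cases (t + 1) 0 with h1 | h1 <;> rcases max_cases t 0 with h2 | h2 <;>
    rcases max_cases (t - 1) 0 with h3 | h3 <;> linarith

lemma hat_le_one (t : ℝ) : hat t ≤ 1 := by
  unfold hat
  rcases max_cases (t + 1) 0 with h1 | h1 <;> rcases max_cases t 0 with h2 | h2 <;>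
    rcases max_cases (t - 1) 0 with h3 | h3 <;> linarith

lemma hat_eq_zero {t : ℝ} (ht : 1 ≤ |t|) : hat t = 0 := by
  unfold hat
  rcases le_abs.1 ht with h | h
  · rw [max_eq_left (by linarith), max_eq_left (by linarith), max_eq_left (by linarith)]; ring
  · rw [max_eq_right (by linarith), max_eq_right (by linarith), max_eq_right (by linarith)]; ring

/-- A hat is the difference of two consecutive unit ramps, so the sum telescopes. -/
lemma sum_hat {N : ℕ} {t : ℝ} (h0 : 0 ≤ t) (hN : t ≤ N) :
    ∑ m : Fin (N + 1), hat (t - (m : ℕ)) = 1 := by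
  rw [← Finset.sum_range (fun m => hat (t - m))]
  have h : ∀ m : ℕ, hat (t - m) =
      (max (t - m + 1) 0 - max (t - m) 0) -
        (max (t - (m + 1 : ℕ) + 1) 0 - max (t - (m + 1 : ℕ)) 0) := by
    intro m
    unfold hat
    have h1 : t - ((m + 1 : ℕ) : ℝ) + 1 = t - m := by push_cast; ring
    have h2 : t - ((m + 1 : ℕ) : ℝ) = t - m - 1 := by push_cast; ring
    rw [h1, h2]
    ring
  simp_rw [h]
  rw [Finset.sum_range_sub' (fun m : ℕ => max (t - m + 1) 0 - max (t - m) 0)]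
  push_cast
  rw [max_eq_left (by linarith), max_eq_left (by linarith), max_eq_right (by linarith),
    max_eq_right (by linarith)]
  ring

/-- At each point at most two of the translated hat functions do not vanish. -/
lemma card_hat_ne_zero (N : ℕ) {t : ℝ} (h0 : 0 ≤ t) :
    (Finset.univ.filter fun m : Fin (N + 1) => hat (t - (m : ℕ)) ≠ 0).card ≤ 2 := by
  have hsub : (Finset.univ.filter fun m : Fin (N + 1) => hat (t - (m : ℕ)) ≠ 0).image
      (fun m : Fin (N + 1) => (m : ℕ)) ⊆ {⌊t⌋₊, ⌊t⌋₊ + 1} := by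
    intro m hm
    simp only [Finset.mem_image, Finset.mem_filter, Finset.mem_univ, true_and] at hm
    obtain ⟨m, hm, rfl⟩ := hm
    have hlt : |t - (m : ℕ)| < 1 := by
      by_contra hge
      exact hm (hat_eq_zero (not_lt.1 hge))
    rw [abs_lt] at hlt
    have h1 := Nat.floor_le h0
    have h2 := Nat.lt_floor_add_one t
    have h3 : ⌊t⌋₊ < (m : ℕ) + 1 := by
      have : ((⌊t⌋₊ : ℕ) : ℝ) < ((m : ℕ) + 1 : ℕ) := by push_cast; linarith
      exact_mod_cast this
    have h4 : (m : ℕ) < ⌊t⌋₊ + 2 := by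
      have : (((m : ℕ) : ℕ) : ℝ) < (⌊t⌋₊ + 2 : ℕ) := by push_cast; linarith
      exact_mod_cast this
    simp only [Finset.mem_insert, Finset.mem_singleton]
    omega
  rw [← Finset.card_image_of_injective _ Fin.val_injective]
  exact (Finset.card_le_card hsub).trans Finset.card_le_two

end Hat

/-! ### Realization by networks of prescribed width and depth. -/

section Realization

variable {I J : Type} [Fintype I] [Fintype J] {W : ℕ}

lemma sum_extend_mul_extend {e : I → Fin W} (he : Function.Injective e) (a φ : I → ℝ) :
    ∑ q, Function.extend e a 0 q * Function.extend e φ 0 q = ∑ j, a j * φ j := by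
  symm
  refine Fintype.sum_of_injective e he _ _ (fun q hq => ?_) (fun j => ?_)
  · rw [Function.extend_apply' _ _ _ (by simpa using hq)]
    simp
  · rw [he.extend_apply, he.extend_apply]

lemma sum_abs_extend {e : I → Fin W} (he : Function.Injective e) (a : I → ℝ) :
    ∑ q, |Function.extend e a 0 q| = ∑ j, |a j| := by
  symm
  refine Fintype.sum_of_injective e he _ _ (fun q hq => ?_) (fun j => ?_)
  · rw [Function.extend_apply' _ _ _ (by simpa using hq)]
    simp
  · rw [he.extend_apply]

/-- A matrix padded with zeros, as a matrix between layers of `W` neurons. -/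
def padMatrix {n : ℕ} (e : J → Fin W) (a : J → Fin n → ℝ) : Matrix (Fin W) (Fin n) ℝ :=
  Function.extend e a 0

/-- Rows outside the range of `e` have zero weights and bias and give dead neurons; this makes the
width exactly `W`. -/
lemma padMatrix_layer {n : ℕ} {e : J → Fin W} (he : Function.Injective e) (a : J → Fin n → ℝ)
    (b : J → ℝ) (v : Fin n → ℝ) (p : Fin W) :
    max (((padMatrix e a).mulVec v + Function.extend e b 0) p) 0 =
      Function.extend e (fun j => max (∑ q, a j q * v q + b j) 0) 0 p := by
  by_cases hp : ∃ j, e j = p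
  · obtain ⟨j, rfl⟩ := hp
    simp only [Pi.add_apply, Matrix.mulVec, dotProduct, padMatrix, he.extend_apply]
  · simp only [Pi.add_apply, Matrix.mulVec, dotProduct, padMatrix,
      Function.extend_apply' _ _ _ hp, Pi.zero_apply]
    simp

section

attribute [local instance] Matrix.linftyOpNormedAddCommGroup

lemma padMatrix_norm_le {n : ℕ} {e : J → Fin W} (he : Function.Injective e) (a : J → Fin n → ℝ)
    (b : J → ℝ) {M : ℝ} (hM : 0 ≤ M) (h : ∀ j, ∑ q, |a j q| + |b j| ≤ M) :
    ‖Matrix.fromCols (padMatrix e a) (Matrix.replicateCol (Fin 1) (Function.extend e b 0))‖ ≤ M := by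
  refine linfty_norm_le _ hM fun p => ?_
  simp only [Fintype.sum_sum_type, Matrix.fromCols_apply_inl, Matrix.fromCols_apply_inr,
    Matrix.replicateCol_apply, Finset.univ_unique, Finset.sum_singleton]
  by_cases hp : ∃ j, e j = p
  · obtain ⟨j, rfl⟩ := hp
    simpa only [padMatrix, he.extend_apply] using h j
  · simp only [padMatrix, Function.extend_apply' _ _ _ hp, Pi.zero_apply]
    simpa using hM

end

/-- A network all of whose hidden layers have the same number of neurons. -/
def uniformNet {d : ℕ} (L : ℕ) (hW : 1 ≤ W) (A₀ : Matrix (Fin W) (Fin d) ℝ)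
    (A : ℕ → Matrix (Fin W) (Fin W) ℝ) (b : ℕ → Fin W → ℝ) (out : Matrix (Fin 1) (Fin W) ℝ) :
    ReLUNet d 1 (L + 1) where
  N := fun _ => W
  N_pos := fun _ _ => hW
  A := fun ℓ => match ℓ with
    | 0 => A₀
    | ℓ + 1 => A ℓ
  b := b
  out := out

/-- The output of the `(ℓ + 1)`-st layer of a network whose layers have `W` neurons. -/
def uniformHidden {d : ℕ} (A₀ : Matrix (Fin W) (Fin d) ℝ) (A : ℕ → Matrix (Fin W) (Fin W) ℝ)
    (b : ℕ → Fin W → ℝ) (x : Fin d → ℝ) : ℕ → Fin W → ℝ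
  | 0 => fun p => max ((A₀.mulVec x + b 0) p) 0
  | ℓ + 1 => fun p => max (((A ℓ).mulVec (uniformHidden A₀ A b x ℓ) + b (ℓ + 1)) p) 0

lemma uniformNet_eval {d : ℕ} (L : ℕ) (hW : 1 ≤ W) (A₀ : Matrix (Fin W) (Fin d) ℝ)
    (A : ℕ → Matrix (Fin W) (Fin W) ℝ) (b : ℕ → Fin W → ℝ) (out : Matrix (Fin 1) (Fin W) ℝ)
    (x : Fin d → ℝ) :
    (uniformNet L hW A₀ A b out).eval x = out.mulVec (uniformHidden A₀ A b x L) := by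
  have h : ∀ ℓ, (uniformNet L hW A₀ A b out).hidden x (ℓ + 1) = uniformHidden A₀ A b x ℓ := by
    intro ℓ
    induction ℓ with
    | zero => rfl
    | succ ℓ ih =>
      funext p
      exact congrArg (fun v : Fin W → ℝ => max (((A ℓ).mulVec v + b (ℓ + 1)) p) 0) ih
  exact congrArg (fun v : Fin W → ℝ => out.mulVec v) (h L)

lemma uniformNet_width {d : ℕ} (L : ℕ) (hW : 1 ≤ W) (A₀ : Matrix (Fin W) (Fin d) ℝ)
    (A : ℕ → Matrix (Fin W) (Fin W) ℝ) (b : ℕ → Fin W → ℝ) (out : Matrix (Fin 1) (Fin W) ℝ) :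
    (uniformNet L hW A₀ A b out).width = W :=
  le_antisymm (Finset.sup_le fun _ _ => le_rfl)
    (Finset.le_sup (f := (uniformNet L hW A₀ A b out).N) (Finset.mem_range.2 L.succ_pos))

attribute [local instance] Matrix.linftyOpNormedAddCommGroup in
lemma uniformNet_kappa_le {d : ℕ} (L : ℕ) (hW : 1 ≤ W) (A₀ : Matrix (Fin W) (Fin d) ℝ)
    (A : ℕ → Matrix (Fin W) (Fin W) ℝ) (b : ℕ → Fin W → ℝ) (out : Matrix (Fin 1) (Fin W) ℝ)
    (g : ℕ → ℝ) {M : ℝ} (hg : ∀ ℓ, 1 ≤ g ℓ)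
    (h₀ : ‖Matrix.fromCols A₀ (Matrix.replicateCol (Fin 1) (b 0))‖ ≤ g 0)
    (h : ∀ ℓ, ‖Matrix.fromCols (A ℓ) (Matrix.replicateCol (Fin 1) (b (ℓ + 1)))‖ ≤ g (ℓ + 1))
    (hout : ‖out‖ ≤ M) :
    (uniformNet L hW A₀ A b out).kappa ≤ M * ∏ ℓ ∈ Finset.range (L + 1), g ℓ := by
  refine mul_le_mul hout (Finset.prod_le_prod (fun _ _ => zero_le_one.trans (le_max_right _ _))
    fun ℓ _ => ?_) (Finset.prod_nonneg fun _ _ => zero_le_one.trans (le_max_right _ _))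
    ((norm_nonneg _).trans hout)
  match ℓ with
  | 0 => exact max_le h₀ (hg 0)
  | ℓ + 1 => exact max_le (h ℓ) (hg (ℓ + 1))

variable {K : Type} [Fintype K]

/-- Realization of a function computed by three layers of neurons by a network with exactly `W`
neurons in each of at least three layers. -/
lemma exists_uniform_net {d L : ℕ} (hL : 3 ≤ L) (hW : 1 ≤ W) (hI : Fintype.card I ≤ W)
    (hJ : Fintype.card J ≤ W) (hK : Fintype.card K ≤ W)
    (a₁ : I → Fin d → ℝ) (b₁ : I → ℝ) (a₂ : J → I → ℝ) (b₂ : J → ℝ) (a₃ : K → J → ℝ) (b₃ : K → ℝ)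
    (c : K → ℝ) {M₁ M₂ M₃ M₄ : ℝ} (hM₁ : 1 ≤ M₁) (hM₂ : 1 ≤ M₂) (hM₃ : 1 ≤ M₃) (hM₄ : 0 ≤ M₄)
    (h₁ : ∀ i, ∑ q, |a₁ i q| + |b₁ i| ≤ M₁) (h₂ : ∀ j, ∑ i, |a₂ j i| + |b₂ j| ≤ M₂)
    (h₃ : ∀ k, ∑ j, |a₃ k j| + |b₃ k| ≤ M₃) (h₄ : ∑ k, |c k| ≤ M₄) :
    ∃ θ : ReLUNet d 1 L, θ.width = W ∧ θ.kappa ≤ M₄ * (M₁ * M₂ * M₃) ∧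
      ∀ x i, θ.eval x i = ∑ k, c k * max (∑ j, a₃ k j * max (∑ i, a₂ j i *
        max (∑ q, a₁ i q * x q + b₁ i) 0 + b₂ j) 0 + b₃ k) 0 := by
  obtain ⟨L, rfl⟩ : ∃ L', L = L' + 3 := ⟨L - 3, by omega⟩
  have hemb : ∀ (T : Type) [Fintype T], Fintype.card T ≤ W → ∃ e : T → Fin W, Function.Injective e := by
    intro T _ hT
    obtain ⟨e⟩ := Function.Embedding.nonempty_of_card_le (α := T) (β := Fin W) (by simpa using hT)
    exact ⟨e, e.injective⟩
  obtain ⟨e₁, he₁⟩ := hemb I hI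
  obtain ⟨e₂, he₂⟩ := hemb J hJ
  obtain ⟨e₃, he₃⟩ := hemb K hK
  let A : ℕ → Matrix (Fin W) (Fin W) ℝ := fun ℓ => match ℓ with
    | 0 => padMatrix e₂ fun j => Function.extend e₁ (a₂ j) 0
    | 1 => padMatrix e₃ fun k => Function.extend e₂ (a₃ k) 0
    | _ + 2 => 1
  let b : ℕ → Fin W → ℝ := fun ℓ => match ℓ with
    | 0 => Function.extend e₁ b₁ 0
    | 1 => Function.extend e₂ b₂ 0
    | 2 => Function.extend e₃ b₃ 0
    | _ + 3 => 0
  have hid1 : ∀ x, uniformHidden (padMatrix e₁ a₁) A b x 0 =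
      Function.extend e₁ (fun i => max (∑ q, a₁ i q * x q + b₁ i) 0) 0 := fun x =>
    funext fun p => padMatrix_layer he₁ a₁ b₁ x p
  have hid2 : ∀ x, uniformHidden (padMatrix e₁ a₁) A b x 1 = Function.extend e₂ (fun j =>
      max (∑ i, a₂ j i * max (∑ q, a₁ i q * x q + b₁ i) 0 + b₂ j) 0) 0 := by
    intro x
    funext p
    refine (padMatrix_layer he₂ (fun j => Function.extend e₁ (a₂ j) 0) b₂ _ p).trans ?_
    simp only [hid1, sum_extend_mul_extend he₁]
  have hid3 : ∀ x, uniformHidden (padMatrix e₁ a₁) A b x 2 = Function.extend e₃ (fun k =>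
      max (∑ j, a₃ k j * max (∑ i, a₂ j i * max (∑ q, a₁ i q * x q + b₁ i) 0 + b₂ j) 0 + b₃ k) 0)
        0 := by
    intro x
    funext p
    refine (padMatrix_layer he₃ (fun k => Function.extend e₂ (a₃ k) 0) b₃ _ p).trans ?_
    simp only [hid2, sum_extend_mul_extend he₂]
  -- Surplus depth is filled with identity layers: outputs of ReLUs are nonnegative, hence
  -- unchanged, and norm 1 leaves κ unchanged.
  have hid : ∀ ℓ x, uniformHidden (padMatrix e₁ a₁) A b x (ℓ + 2) =
      uniformHidden (padMatrix e₁ a₁) A b x 2 := by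
    intro ℓ x
    induction ℓ with
    | zero => rfl
    | succ ℓ ih =>
      rw [← ih]
      funext p
      have hpos : 0 ≤ uniformHidden (padMatrix e₁ a₁) A b x (ℓ + 2) p := le_max_right _ _
      change max (((1 : Matrix (Fin W) (Fin W) ℝ).mulVec
        (uniformHidden (padMatrix e₁ a₁) A b x (ℓ + 2)) + (0 : Fin W → ℝ)) p) 0 = _
      rw [Matrix.one_mulVec, add_zero, max_eq_left hpos]
  let g : ℕ → ℝ := fun ℓ => match ℓ with
    | 0 => M₁
    | 1 => M₂
    | 2 => M₃
    | _ + 3 => 1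
  have hg1 : ∀ ℓ, 1 ≤ g ℓ := fun ℓ => match ℓ with
    | 0 => hM₁
    | 1 => hM₂
    | 2 => hM₃
    | _ + 3 => le_rfl
  have hg : ∏ ℓ ∈ Finset.range (L + 3), g ℓ = M₁ * M₂ * M₃ := by
    rw [add_comm, Finset.prod_range_add]
    have : ∀ ℓ, g (3 + ℓ) = 1 := fun ℓ => by rw [add_comm]
    simp only [this, Finset.prod_const_one, mul_one, Finset.prod_range_succ,
      Finset.prod_range_zero, one_mul, g]
  refine ⟨uniformNet (L + 2) hW (padMatrix e₁ a₁) A b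
    (Matrix.of fun _ => Function.extend e₃ c 0),
    uniformNet_width _ _ _ _ _ _, ?_, ?_⟩
  · rw [← hg]
    refine uniformNet_kappa_le _ _ _ _ _ _ g hg1
      (padMatrix_norm_le he₁ a₁ b₁ (zero_le_one.trans hM₁) h₁) (fun ℓ => ?_)
      (linfty_norm_le _ hM₄ fun _ => (sum_abs_extend he₃ c).trans_le h₄)
    match ℓ with
    | 0 =>
      exact padMatrix_norm_le he₂ (fun j => Function.extend e₁ (a₂ j) 0) b₂
        (zero_le_one.trans hM₂) fun j => by simpa only [sum_abs_extend he₁] using h₂ j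
    | 1 =>
      exact padMatrix_norm_le he₃ (fun k => Function.extend e₂ (a₃ k) 0) b₃
        (zero_le_one.trans hM₃) fun j => by simpa only [sum_abs_extend he₂] using h₃ j
    | ℓ + 2 =>
      refine linfty_norm_le _ zero_le_one fun p => ?_
      simp [A, b, g, Fintype.sum_sum_type, Matrix.one_apply, apply_ite abs]
  · intro x i
    rw [uniformNet_eval, hid, hid3]
    exact sum_extend_mul_extend he₃ c _

/-- Truncation of a two-layer network to the values in `[-1, 1]` costs one further layer. -/
lemma exists_clipped_net {d L : ℕ} (hL : 3 ≤ L) (hW : 3 ≤ W) (hI : Fintype.card I ≤ W)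
    (hJ : Fintype.card J ≤ W)
    (a₁ : I → Fin d → ℝ) (b₁ : I → ℝ) (a₂ : J → I → ℝ) (b₂ : J → ℝ) (a₃ : J → ℝ)
    {M₁ M₂ M₃ : ℝ} (hM₁ : 1 ≤ M₁) (hM₂ : 1 ≤ M₂)
    (h₁ : ∀ i, ∑ q, |a₁ i q| + |b₁ i| ≤ M₁) (h₂ : ∀ j, ∑ i, |a₂ j i| + |b₂ j| ≤ M₂)
    (h₃ : ∑ j, |a₃ j| ≤ M₃) :
    ∃ θ ∈ ReLUNet.boundedClass d 1 W L 1, θ.kappa ≤ 3 * (M₁ * M₂ * (M₃ + 1)) ∧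
      ∀ x (y : ℝ), |y| ≤ 1 → |θ.eval x 0 - y| ≤ |∑ j, a₃ j * max (∑ i, a₂ j i *
        max (∑ q, a₁ i q * x q + b₁ i) 0 + b₂ j) 0 - y| := by
  have hM₃ : 0 ≤ M₃ := (Finset.sum_nonneg fun _ _ => abs_nonneg _).trans h₃
  -- Clipping is `σ(z + 1) - σ(z - 1) - σ(1)`. The output layer has no bias, so the constant takes a
  -- third neuron; the three output weights have absolute sum 3.
  obtain ⟨θ, hw, hκ, heval⟩ := exists_uniform_net (K := Fin 3) hL (by omega) hI hJ (by simpa using hW)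
    a₁ b₁ a₂ b₂ ![a₃, a₃, 0] ![1, -1, 1] ![1, -1, -1] (M₃ := M₃ + 1) (M₄ := 3) hM₁ hM₂
    (by linarith) (by norm_num) h₁ h₂ (by
      intro k
      fin_cases k
      · simpa using h₃
      · simpa using h₃
      · simpa using hM₃)
    (by simp [Fin.sum_univ_three]; norm_num)
  have hform : ∀ x i, θ.eval x i = max ((∑ j, a₃ j * max (∑ i, a₂ j i *
        max (∑ q, a₁ i q * x q + b₁ i) 0 + b₂ j) 0) + 1) 0 - max ((∑ j, a₃ j * max (∑ i, a₂ j i *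
        max (∑ q, a₁ i q * x q + b₁ i) 0 + b₂ j) 0) - 1) 0 - 1 := by
    intro x i
    rw [heval, Fin.sum_univ_three]
    simp
    ring_nf
  refine ⟨θ, ⟨hw, fun x i => ?_⟩, hκ, fun x y hy => ?_⟩
  · rw [hform]
    set z := ∑ j, a₃ j * max (∑ i, a₂ j i * max (∑ q, a₁ i q * x q + b₁ i) 0 + b₂ j) 0
    constructor <;> rcases max_cases (z + 1) 0 with h | h <;> rcases max_cases (z - 1) 0 with h' | h' <;>
      linarith
  · rw [hform]
    set z := ∑ j, a₃ j * max (∑ i, a₂ j i * max (∑ q, a₁ i q * x q + b₁ i) 0 + b₂ j) 0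
    rw [abs_le] at hy
    rcases max_cases (z + 1) 0 with h | h <;> rcases max_cases (z - 1) 0 with h' | h' <;>
      rw [h.1, h'.1]
    · rw [abs_le]
      have := le_abs_self (z - y)
      constructor <;> linarith
    · apply le_of_eq; congr 1; ring
    · linarith
    · rw [abs_le]
      have := neg_le_abs (z - y)
      constructor <;> linarith

end Realization

/-! ### Bookkeeping of coefficient norms. -/

section AffineComb

variable {I X : Type*} [Fintype I]

/-- On the set `S`, the function `h` is an affine combination of the functions `φ i` whose
coefficients have absolute sum at most `M`. -/
def AffineComb (φ : I → X → ℝ) (S : Set X) (M : ℝ) (h : X → ℝ) : Prop :=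
  ∃ (a : I → ℝ) (b : ℝ), ∑ i, |a i| + |b| ≤ M ∧ ∀ x ∈ S, ∑ i, a i * φ i x + b = h x

namespace AffineComb

variable {φ : I → X → ℝ} {S : Set X} {M M' : ℝ} {h h' : X → ℝ}

lemma of_neuron [DecidableEq I] (φ : I → X → ℝ) (S : Set X) (i : I) :
    AffineComb φ S 1 (φ i) := by
  refine ⟨Pi.single i 1, 0, ?_, fun x _ => ?_⟩
  · simp [Pi.single_apply, apply_ite abs]
  · simp [Pi.single_apply]

lemma of_const (φ : I → X → ℝ) (S : Set X) (c : ℝ) : AffineComb φ S |c| (fun _ => c) :=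
  ⟨0, c, by simp, by simp⟩

lemma mono (hh : AffineComb φ S M h) (hM : M ≤ M') : AffineComb φ S M' h := by
  obtain ⟨a, b, h1, h2⟩ := hh
  exact ⟨a, b, h1.trans hM, h2⟩

lemma congr (hh : AffineComb φ S M h) (heq : ∀ x ∈ S, h x = h' x) : AffineComb φ S M h' := by
  obtain ⟨a, b, h1, h2⟩ := hh
  exact ⟨a, b, h1, fun x hx => (h2 x hx).trans (heq x hx)⟩

lemma add (hh : AffineComb φ S M h) (hh' : AffineComb φ S M' h') :
    AffineComb φ S (M + M') (fun x => h x + h' x) := by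
  obtain ⟨a, b, h1, h2⟩ := hh
  obtain ⟨a', b', h1', h2'⟩ := hh'
  refine ⟨fun i => a i + a' i, b + b', ?_, fun x hx => ?_⟩
  · have h3 : ∑ i, |a i + a' i| ≤ ∑ i, |a i| + ∑ i, |a' i| := by
      rw [← Finset.sum_add_distrib]
      exact Finset.sum_le_sum fun i _ => abs_add_le _ _
    linarith [abs_add_le b b']
  · beta_reduce
    rw [← h2 x hx, ← h2' x hx]
    simp only [add_mul, Finset.sum_add_distrib]
    ring

lemma const_mul (hh : AffineComb φ S M h) (c : ℝ) :
    AffineComb φ S (|c| * M) (fun x => c * h x) := by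
  obtain ⟨a, b, h1, h2⟩ := hh
  refine ⟨fun i => c * a i, c * b, ?_, fun x hx => ?_⟩
  · simp only [abs_mul, ← Finset.mul_sum]
    rw [← mul_add]
    exact mul_le_mul_of_nonneg_left h1 (abs_nonneg _)
  · beta_reduce
    rw [← h2 x hx, mul_add, Finset.mul_sum]
    simp only [mul_assoc]

lemma sum {T : Type*} (s : Finset T) {H : T → X → ℝ} {B : T → ℝ}
    (hH : ∀ t, AffineComb φ S (B t) (H t)) :
    AffineComb φ S (∑ t ∈ s, B t) (fun x => ∑ t ∈ s, H t x) := by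
  classical
  induction s using Finset.induction_on with
  | empty => simpa using of_const φ S 0
  | insert t s ht ih => simpa [Finset.sum_insert ht] using (hH t).add ih

end AffineComb

end AffineComb

/-! ### Localized Taylor polynomials. -/

section LocalTaylor

variable {d : ℕ}

/-- The node of the grid `(1/N) ℤ^d` with index `m`. -/
def gridPoint {N : ℕ} (m : Fin d → Fin (N + 1)) : Fin d → ℝ := fun i => (m i : ℕ) / N

/-- The factors of a term of the localized Taylor polynomial at a grid point. -/
def localFactor {N j : ℕ} (m : Fin d → Fin (N + 1)) (s : Fin j → Fin d) (x : Fin d → ℝ) :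
    Fin d ⊕ Fin j → ℝ :=
  Sum.elim (fun i => hat (N * x i - (m i : ℕ))) (fun l => x (s l) - gridPoint m (s l))

/-- The localized Taylor polynomials of `f`, with the products replaced by the functions `Q j`. -/
def localTaylor (N r : ℕ) (f : (Fin d → ℝ) → ℝ) (Q : (j : ℕ) → (Fin d ⊕ Fin j → ℝ) → ℝ)
    (x : Fin d → ℝ) : ℝ :=
  ∑ m : Fin d → Fin (N + 1), ∑ j : Fin (r + 1), ∑ s : Fin j → Fin d,
    mixedPartial s f (gridPoint m) / ((j : ℕ).factorial : ℝ) * Q j (localFactor m s x)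

lemma abs_coeff_le_one {r : ℕ} {β : ℝ} {f : (Fin d → ℝ) → ℝ} (hf : f ∈ HolderClass d r β)
    {j : ℕ} (hj : j ≤ r) (s : Fin j → Fin d) (y : Fin d → ℝ) :
    |mixedPartial s f y / (j.factorial : ℝ)| ≤ 1 := by
  rw [abs_div, Nat.abs_cast]
  have h1 := hf.2.1 j hj s y
  have h2 : (1 : ℝ) ≤ (j.factorial : ℝ) := by
    exact_mod_cast Nat.one_le_iff_ne_zero.2 (Nat.factorial_ne_zero _)
  exact (div_le_one (by linarith)).2 (h1.trans h2)

lemma sum_prod_hat {N : ℕ} (hN : 0 < N) {x : Fin d → ℝ} (hx : x ∈ Set.Icc (0 : Fin d → ℝ) 1) :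
    ∑ m : Fin d → Fin (N + 1), ∏ i, hat (N * x i - (m i : ℕ)) = 1 := by
  have hN' : (0 : ℝ) < N := by exact_mod_cast hN
  have h := Finset.prod_univ_sum (fun _ : Fin d => (Finset.univ : Finset (Fin (N + 1))))
    (fun i m => hat (N * x i - (m : ℕ)))
  rw [Fintype.piFinset_univ] at h
  rw [← h]
  refine Finset.prod_eq_one fun i _ => sum_hat (mul_nonneg hN'.le (hx.1 i)) ?_
  have : x i ≤ 1 := hx.2 i
  nlinarith

lemma card_active_cells_le {N : ℕ} {x : Fin d → ℝ}
    (hx : x ∈ Set.Icc (0 : Fin d → ℝ) 1) :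
    (Finset.univ.filter fun m : Fin d → Fin (N + 1) =>
      ∀ i, hat (N * x i - (m i : ℕ)) ≠ 0).card ≤ 2 ^ d := by
  have heq : (Finset.univ.filter fun m : Fin d → Fin (N + 1) =>
      ∀ i, hat (N * x i - (m i : ℕ)) ≠ 0) =
      Fintype.piFinset fun i => Finset.univ.filter fun m : Fin (N + 1) =>
        hat (N * x i - (m : ℕ)) ≠ 0 := by
    ext m
    simp [Fintype.mem_piFinset]
  rw [heq, Fintype.card_piFinset]
  refine (Finset.prod_le_prod' fun i _ =>
    card_hat_ne_zero N (mul_nonneg (Nat.cast_nonneg N) (hx.1 i))).trans ?_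
  simp

lemma abs_localFactor_le_one {N j : ℕ} (hN : 0 < N) (m : Fin d → Fin (N + 1)) (s : Fin j → Fin d)
    {x : Fin d → ℝ} (hx : x ∈ Set.Icc (0 : Fin d → ℝ) 1) (i : Fin d ⊕ Fin j) :
    |localFactor m s x i| ≤ 1 := by
  have hN' : (0 : ℝ) < N := by exact_mod_cast hN
  rcases i with i | l
  · simp only [localFactor, Sum.elim_inl]
    rw [abs_of_nonneg (hat_nonneg _)]
    exact hat_le_one _
  · simp only [localFactor, Sum.elim_inr, gridPoint]
    have h1 : 0 ≤ x (s l) := hx.1 _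
    have h2 : x (s l) ≤ 1 := hx.2 _
    have h3 : (0 : ℝ) ≤ ((m (s l) : ℕ) : ℝ) / N := by positivity
    have h4 : ((m (s l) : ℕ) : ℝ) / N ≤ 1 := by
      rw [div_le_one hN']
      exact_mod_cast Nat.lt_succ_iff.1 (m (s l)).2
    rw [abs_le]
    constructor <;> linarith

/-- The hat products sum to 1, so the error splits into a weighted mean of Taylor errors at nodes
within 1/N of `x` and the errors of the approximate products. -/
lemma abs_sub_localTaylor_le {N r : ℕ} (hN : 0 < N) {β : ℝ} (hβ : 0 < β) {f : (Fin d → ℝ) → ℝ}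
    (hf : f ∈ HolderClass d r β) (Q : (j : ℕ) → (Fin d ⊕ Fin j → ℝ) → ℝ) {E : ℝ}
    (hQ : ∀ j ≤ r, ∀ u, (∀ i, |u i| ≤ 1) → |∏ i, u i - Q j u| ≤ E)
    (hQ0 : ∀ j ≤ r, ∀ u, (∃ i, u i = 0) → Q j u = 0)
    {x : Fin d → ℝ} (hx : x ∈ Set.Icc (0 : Fin d → ℝ) 1) :
    |f x - localTaylor N r f Q x| ≤
      d ^ r * ((1 / N : ℝ) ^ r * (1 / N : ℝ) ^ β) + 2 ^ d * ((∑ j : Fin (r + 1), (d : ℝ) ^ (j : ℕ)) * E) := by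
  have hN' : (0 : ℝ) < N := by exact_mod_cast hN
  have hE : 0 ≤ E := (abs_nonneg _).trans (hQ 0 (Nat.zero_le _) (fun _ => 0) (by simp))
  have hprod : ∀ (m : Fin d → Fin (N + 1)),
      (∏ i, hat (N * x i - (m i : ℕ))) * taylorPoly f r (gridPoint m) x =
        ∑ j : Fin (r + 1), ∑ s : Fin j → Fin d,
          mixedPartial s f (gridPoint m) / ((j : ℕ).factorial : ℝ) *
            ∏ i, localFactor m s x i := by
    intro m
    rw [taylorPoly, Finset.sum_range, Finset.mul_sum]
    refine Finset.sum_congr rfl fun j _ => ?_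
    rw [Finset.mul_sum]
    refine Finset.sum_congr rfl fun s _ => ?_
    rw [Fintype.prod_sum_type]
    simp only [localFactor, Sum.elim_inl, Sum.elim_inr]
    ring
  have hsplit : f x - localTaylor N r f Q x =
      (∑ m : Fin d → Fin (N + 1), (∏ i, hat (N * x i - (m i : ℕ))) *
        (f x - taylorPoly f r (gridPoint m) x)) +
      ∑ m : Fin d → Fin (N + 1), ∑ j : Fin (r + 1), ∑ s : Fin j → Fin d,
        mixedPartial s f (gridPoint m) / ((j : ℕ).factorial : ℝ) *
          (∏ i, localFactor m s x i - Q j (localFactor m s x)) := by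
    simp only [mul_sub, Finset.sum_sub_distrib, hprod, ← Finset.sum_mul, sum_prod_hat hN hx]
    rw [localTaylor]
    ring
  rw [hsplit]
  refine (abs_add_le _ _).trans (add_le_add ?_ ?_)
  · have hterm : ∀ m : Fin d → Fin (N + 1), |(∏ i, hat (N * x i - (m i : ℕ))) *
        (f x - taylorPoly f r (gridPoint m) x)| ≤
        (∏ i, hat (N * x i - (m i : ℕ))) * (d ^ r * ((1 / N : ℝ) ^ r * (1 / N : ℝ) ^ β)) := by
      intro m
      have hnn : 0 ≤ ∏ i, hat (N * x i - (m i : ℕ)) := Finset.prod_nonneg fun _ _ => hat_nonneg _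
      rw [abs_mul, abs_of_nonneg hnn]
      rcases hnn.eq_or_lt with h0 | hpos
      · rw [← h0]; simp
      · refine mul_le_mul_of_nonneg_left ?_ hnn
        have hclose : ‖x - gridPoint m‖ ≤ 1 / N := by
          refine (pi_norm_le_iff_of_nonneg (by positivity)).2 fun i => ?_
          have hne : hat (N * x i - (m i : ℕ)) ≠ 0 :=
            fun h => hpos.ne' (Finset.prod_eq_zero (Finset.mem_univ i) h)
          have hlt : |N * x i - (m i : ℕ)| ≤ 1 := by
            by_contra hge
            exact hne (hat_eq_zero (not_le.1 hge).le)
          have heq : (x - gridPoint m) i = (N * x i - (m i : ℕ)) / N := by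
            simp only [Pi.sub_apply, gridPoint]
            field_simp
          rw [heq, Real.norm_eq_abs, abs_div, Nat.abs_cast]
          gcongr
        refine (abs_sub_taylorPoly_le hβ hf x (gridPoint m)).trans ?_
        rw [mul_assoc]
        gcongr
    refine (Finset.abs_sum_le_sum_abs _ _).trans ((Finset.sum_le_sum fun m _ => hterm m).trans ?_)
    rw [← Finset.sum_mul, sum_prod_hat hN hx, one_mul]
  -- Exact vanishing (`hQ0`) removes all but the at most `2 ^ d` active cells; otherwise the product
  -- error would be multiplied by the number of cells.
  · set Act := Finset.univ.filter fun m : Fin d → Fin (N + 1) =>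
      ∀ i, hat (N * x i - (m i : ℕ)) ≠ 0 with hAct
    have hzero : ∀ m ∈ Finset.univ, m ∉ Act → ∑ j : Fin (r + 1), ∑ s : Fin j → Fin d,
        mixedPartial s f (gridPoint m) / ((j : ℕ).factorial : ℝ) *
          (∏ i, localFactor m s x i - Q j (localFactor m s x)) = 0 := by
      intro m _ hm
      have : ∃ i, hat (N * x i - (m i : ℕ)) = 0 := by
        by_contra hcon
        push Not at hcon
        exact hm (Finset.mem_filter.2 ⟨Finset.mem_univ _, hcon⟩)
      obtain ⟨i, hi⟩ := this
      refine Finset.sum_eq_zero fun j _ => Finset.sum_eq_zero fun s _ => ?_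
      have hi' : localFactor m s x (Sum.inl i) = 0 := hi
      rw [hQ0 j (Nat.lt_succ_iff.1 j.2) _ ⟨_, hi'⟩, Finset.prod_eq_zero (Finset.mem_univ _) hi']
      simp
    rw [← Finset.sum_subset (Finset.subset_univ Act) hzero]
    have hterm : ∀ m : Fin d → Fin (N + 1), |∑ j : Fin (r + 1), ∑ s : Fin j → Fin d,
        mixedPartial s f (gridPoint m) / ((j : ℕ).factorial : ℝ) *
          (∏ i, localFactor m s x i - Q j (localFactor m s x))| ≤
        (∑ j : Fin (r + 1), (d : ℝ) ^ (j : ℕ)) * E := by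
      intro m
      rw [Finset.sum_mul]
      refine (Finset.abs_sum_le_sum_abs _ _).trans (Finset.sum_le_sum fun j _ => ?_)
      have hj : (j : ℕ) ≤ r := Nat.lt_succ_iff.1 j.2
      refine (Finset.abs_sum_le_sum_abs _ _).trans
        ((Finset.sum_le_sum (g := fun _ => E) fun s _ => ?_).trans (by simp))
      rw [abs_mul]
      calc _ ≤ 1 * E := by
            gcongr
            · exact abs_coeff_le_one hf hj s _
            · exact hQ j hj _ (abs_localFactor_le_one hN m s hx)
        _ = E := one_mul E
    refine (Finset.abs_sum_le_sum_abs _ _).trans ((Finset.sum_le_sum fun m _ => hterm m).trans ?_)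
    rw [Finset.sum_const, nsmul_eq_mul]
    have hS : 0 ≤ ∑ j : Fin (r + 1), (d : ℝ) ^ (j : ℕ) := Finset.sum_nonneg fun _ _ => by positivity
    gcongr
    exact_mod_cast card_active_cells_le hx

end LocalTaylor

/-! ### The approximating network and its norm. -/

section Approximation

variable {d : ℕ}

/-- The neurons `max (x_i - (q - 1) / N) 0` of the first layer. -/
def gridNeuron (N : ℕ) (p : Fin d × Fin (N + 3)) (x : Fin d → ℝ) : ℝ :=
  max (x p.1 - (((p.2 : ℕ) : ℝ) - 1) / N) 0

/-- A hat is `N` times a second difference of ramps with weights 1, -2, 1, hence `4 * N`. The linear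
factors use that the ramp at 0 (second index 1) is the coordinate itself on the cube. The slope `N`
is thus charged to the second layer. -/
lemma affineComb_localFactor {N j : ℕ} (hN : 0 < N) (m : Fin d → Fin (N + 1)) (s : Fin j → Fin d)
    (i : Fin d ⊕ Fin j) :
    AffineComb (gridNeuron N) (Set.Icc (0 : Fin d → ℝ) 1) (4 * N)
      (fun x => localFactor m s x i) := by
  have hN' : (0 : ℝ) < N := by exact_mod_cast hN
  have hN1 : (1 : ℝ) ≤ N := by exact_mod_cast hN
  rcases i with i | l
  · have hm := (m i).2
    let q : Fin 3 → Fin (N + 3) := fun k => ⟨(m i : ℕ) + k, by omega⟩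
    have h0 := AffineComb.of_neuron (gridNeuron (d := d) N) (Set.Icc (0 : Fin d → ℝ) 1)
    have h := (((h0 (i, q 0)).add ((h0 (i, q 1)).const_mul (-2))).add (h0 (i, q 2))).const_mul N
    refine (h.mono ?_).congr fun x _ => ?_
    · rw [abs_of_pos hN']
      norm_num
      linarith
    · simp only [gridNeuron, localFactor, Sum.elim_inl, hat, q, mul_add]
      have hmul : ∀ z : ℝ, (N : ℝ) * max z 0 = max (N * z) 0 := fun z => by
        rw [mul_max_of_nonneg _ _ hN'.le, mul_zero]
      rw [mul_left_comm, hmul, hmul, hmul]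
      have e0 : (N : ℝ) * (x i - ((((m i : ℕ) + ((0 : Fin 3) : ℕ) : ℕ) : ℝ) - 1) / N) =
          N * x i - (m i : ℕ) + 1 := by
        simp; field_simp; ring
      have e1 : (N : ℝ) * (x i - ((((m i : ℕ) + ((1 : Fin 3) : ℕ) : ℕ) : ℝ) - 1) / N) =
          N * x i - (m i : ℕ) := by
        simp; field_simp
      have e2 : (N : ℝ) * (x i - ((((m i : ℕ) + ((2 : Fin 3) : ℕ) : ℕ) : ℝ) - 1) / N) =
          N * x i - (m i : ℕ) - 1 := by
        simp; field_simp; ring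
      rw [e0, e1, e2]
      ring
  · have h := (AffineComb.of_neuron (gridNeuron (d := d) N) (Set.Icc (0 : Fin d → ℝ) 1)
      (s l, ⟨1, by omega⟩)).add (AffineComb.of_const (gridNeuron (d := d) N)
        (Set.Icc (0 : Fin d → ℝ) 1) (-gridPoint m (s l)))
    refine (h.mono ?_).congr fun x hx => ?_
    · have h3 : (0 : ℝ) ≤ gridPoint m (s l) := by unfold gridPoint; positivity
      have h4 : gridPoint m (s l) ≤ 1 := by
        rw [gridPoint, div_le_one hN']
        exact_mod_cast Nat.lt_succ_iff.1 (m (s l)).2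
      rw [abs_neg, abs_of_nonneg h3]
      linarith
    · have h5 : 0 ≤ x (s l) := hx.1 _
      simp [gridNeuron, localFactor, h5, sub_eq_add_neg]

/-- The index type of the neurons of the second layer. -/
abbrev ProductIndex (d r N k : ℕ) : Type :=
  (Fin d → Fin (N + 1)) × (Σ j : Fin (r + 1), (Fin j → Fin d) × (Fin d ⊕ Fin j → ℤˣ) × Fin k)

set_option maxHeartbeats 1000000 in
/-- Approximation of the functions in the unit ball of the Hölder class by networks of norm
`O(N^{d+1})`, with `N^d` cells and `k` neurons for each product. -/
lemma exists_net_grid (d r : ℕ) (hd : 1 ≤ d) {β : ℝ} (hβ : 0 < β) :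
    ∃ C : ℝ, 1 ≤ C ∧ ∀ N k W L : ℕ, 0 < N → 0 < k → 3 ≤ L → C * ((N : ℝ) ^ d * k) ≤ W →
      ∀ f ∈ HolderClass d r β, ∃ θ ∈ ReLUNet.boundedClass d 1 W L 1,
        θ.kappa ≤ C * (N : ℝ) ^ (d + 1) ∧
        ∀ x ∈ Set.Icc (0 : Fin d → ℝ) 1,
          |θ.eval x 0 - f x| ≤ C * ((1 / N : ℝ) ^ r * (1 / N : ℝ) ^ β + 1 / (k : ℝ) ^ 2) := by
  have hne : Nonempty (Fin d) := ⟨⟨0, by omega⟩⟩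
  choose A hA0 hA using fun j : ℕ => exists_relu_product (Fin d ⊕ Fin j)
  set T : ℝ := ∑ j : Fin (r + 1), (d : ℝ) ^ (j : ℕ) with hT
  set E : ℝ := ∑ j : Fin (r + 1), A j with hE
  set B : ℝ := ∑ j : Fin (r + 1), (d : ℝ) ^ (j : ℕ) * A j with hB
  set S : ℝ := ∑ j : Fin (r + 1), (d : ℝ) ^ (j : ℕ) * 2 ^ (d + j) with hS
  have hT0 : 0 ≤ T := Finset.sum_nonneg fun _ _ => by positivity
  have hE0 : 0 ≤ E := Finset.sum_nonneg fun j _ => (hA0 j).le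
  have hB0 : 0 ≤ B := Finset.sum_nonneg fun j _ => mul_nonneg (by positivity) (hA0 j).le
  have hS0 : 0 ≤ S := Finset.sum_nonneg fun j _ => by positivity
  -- `C₁` serves the width (first layer, the three clipping neurons, product neurons), `C₂` the
  -- bound on κ, `C₃` the error.
  set C₁ : ℝ := 4 * d + 3 + 2 ^ d * S with hC₁
  set C₂ : ℝ := 3 * (3 * (5 * (d + r)) * (2 ^ d * B + 1)) with hC₂
  set C₃ : ℝ := d ^ r + 2 ^ d * (T * E) with hC₃
  have hd1 : (1 : ℝ) ≤ d := by exact_mod_cast hd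
  have hC₁0 : 1 ≤ C₁ := by
    have : (0 : ℝ) ≤ 2 ^ d * S := by positivity
    linarith
  have hC₂0 : 0 ≤ C₂ := by positivity
  have hC₃0 : 0 ≤ C₃ := by positivity
  refine ⟨C₁ + C₂ + C₃, by linarith, fun N k W L hN hk hL hW f hf => ?_⟩
  have hN1 : (1 : ℝ) ≤ N := by exact_mod_cast hN
  have hk1 : (1 : ℝ) ≤ k := by exact_mod_cast hk
  have hN' : (0 : ℝ) < N := by linarith
  choose w τ hτ hw happ hzero using fun j : ℕ => hA j k hk
  have hNd : (N : ℝ) ≤ (N : ℝ) ^ d := le_self_pow₀ hN1 (by omega)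
  have hNd1 : (1 : ℝ) ≤ (N : ℝ) ^ d := one_le_pow₀ hN1
  have hNdk : (N : ℝ) ^ d ≤ (N : ℝ) ^ d * k := le_mul_of_one_le_right (by positivity) hk1
  have hN2 : ((N : ℝ) + 1) ^ d ≤ 2 ^ d * (N : ℝ) ^ d := by
    rw [← mul_pow]
    gcongr
    linarith
  have hW₁ : C₁ * ((N : ℝ) ^ d * k) ≤ W := by
    refine le_trans ?_ hW
    gcongr
    linarith
  have hW3 : 3 ≤ W := by
    have h1 : (0 : ℝ) ≤ 2 ^ d * S := by positivity
    have : (3 : ℝ) ≤ W := by nlinarith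
    exact_mod_cast this
  have hcard1 : Fintype.card (Fin d × Fin (N + 3)) ≤ W := by
    have h1 : (0 : ℝ) ≤ 2 ^ d * S := by positivity
    have : ((Fintype.card (Fin d × Fin (N + 3)) : ℕ) : ℝ) ≤ W := by
      simp only [Fintype.card_prod, Fintype.card_fin]
      push_cast
      calc (d : ℝ) * (N + 3) ≤ d * (4 * ((N : ℝ) ^ d * k)) := by gcongr; linarith
        _ = 4 * d * ((N : ℝ) ^ d * k) := by ring
        _ ≤ C₁ * ((N : ℝ) ^ d * k) := by gcongr; linarith
        _ ≤ W := hW₁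
    exact_mod_cast this
  have hcard2 : Fintype.card (ProductIndex d r N k) ≤ W := by
    have : ((Fintype.card (ProductIndex d r N k) : ℕ) : ℝ) ≤ W := by
      simp only [Fintype.card_prod, Fintype.card_sigma, Fintype.card_fin, Fintype.card_fun,
        Fintype.card_sum, Fintype.card_units_int]
      push_cast
      have h1 : ∑ j : Fin (r + 1), (d : ℝ) ^ (j : ℕ) * (2 ^ (d + (j : ℕ)) * k) = S * k := by
        rw [hS, Finset.sum_mul]
        exact Finset.sum_congr rfl fun j _ => by ring
      rw [h1]
      calc ((N : ℝ) + 1) ^ d * (S * k) ≤ (2 ^ d * (N : ℝ) ^ d) * (S * k) := by gcongr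
        _ = (2 ^ d * S) * ((N : ℝ) ^ d * k) := by ring
        _ ≤ C₁ * ((N : ℝ) ^ d * k) := by gcongr; linarith
        _ ≤ W := hW₁
    exact_mod_cast this
  let pre : ProductIndex d r N k → (Fin d → ℝ) → ℝ := fun p x =>
    ∑ i, ((p.2.2.2.1 i : ℤ) : ℝ) * localFactor p.1 p.2.2.1 x i - τ p.2.1 p.2.2.2.2
  -- At most `d + r` factors of norm `4 * N` each, plus a shift of modulus at most `d + r`.
  have hpre : ∀ p, AffineComb (gridNeuron N) (Set.Icc (0 : Fin d → ℝ) 1)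
      (5 * (d + r) * N) (pre p) := by
    rintro ⟨m, ⟨j, s, ε, l⟩⟩
    have h1 := AffineComb.sum (Finset.univ : Finset (Fin d ⊕ Fin j))
      (fun i => (affineComb_localFactor hN m s i).const_mul ((ε i : ℤ) : ℝ))
    have h2 := h1.add (AffineComb.of_const (gridNeuron (d := d) N)
      (Set.Icc (0 : Fin d → ℝ) 1) (-τ j l))
    refine (h2.mono ?_).congr fun x _ => by simp only [pre]; ring
    have h3 := hτ j l
    simp only [Fintype.card_sum, Fintype.card_fin] at h3
    push_cast at h3
    simp only [abs_sign, one_mul, Finset.sum_const, Finset.card_univ, Fintype.card_sum,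
      Fintype.card_fin, nsmul_eq_mul, abs_neg]
    push_cast
    have hj : (j : ℝ) ≤ r := by exact_mod_cast Nat.lt_succ_iff.1 j.2
    have hj0 : (0 : ℝ) ≤ (j : ℕ) := Nat.cast_nonneg _
    calc ((d : ℝ) + (j : ℕ)) * (4 * N) + |τ j l| ≤ (d + r) * (4 * N) + (d + r) * N := by
          gcongr
          nlinarith
      _ = 5 * (d + r) * N := by ring
  choose a₂ b₂ hab₂ heq₂ using hpre
  let a₃ : ProductIndex d r N k → ℝ := fun p =>
    mixedPartial p.2.2.1 f (gridPoint p.1) / ((p.2.1 : ℕ).factorial : ℝ) *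
      w p.2.1 p.2.2.2.1 p.2.2.2.2
  have ha₃ : ∑ p, |a₃ p| ≤ 2 ^ d * B * (N : ℝ) ^ d := by
    have h1 : ∀ m : Fin d → Fin (N + 1), ∑ q : (Σ j : Fin (r + 1),
        (Fin j → Fin d) × (Fin d ⊕ Fin j → ℤˣ) × Fin k), |a₃ (m, q)| ≤ B := by
      intro m
      rw [Fintype.sum_sigma]
      refine Finset.sum_le_sum fun j _ => ?_
      rw [Fintype.sum_prod_type]
      refine (Finset.sum_le_sum (g := fun _ => A j) fun s _ => ?_).trans (by simp)
      rw [Fintype.sum_prod_type]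
      refine le_trans (Finset.sum_le_sum fun ε _ => Finset.sum_le_sum fun l _ => ?_) (hw j)
      simp only [a₃, abs_mul]
      exact mul_le_of_le_one_left (abs_nonneg _)
        (abs_coeff_le_one hf (Nat.lt_succ_iff.1 j.2) s _)
    rw [Fintype.sum_prod_type]
    refine (Finset.sum_le_sum fun m _ => h1 m).trans ?_
    simp only [Finset.sum_const, Finset.card_univ, Fintype.card_fun, Fintype.card_fin, nsmul_eq_mul]
    push_cast
    calc ((N : ℝ) + 1) ^ d * B ≤ 2 ^ d * (N : ℝ) ^ d * B := by gcongr
      _ = _ := by ring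
  have hneuron : ∀ (p : Fin d × Fin (N + 3)) (x : Fin d → ℝ),
      max (∑ q, (Pi.single p.1 1 : Fin d → ℝ) q * x q + -((((p.2 : ℕ) : ℝ) - 1) / N)) 0 =
        gridNeuron N p x := by
    intro p x
    simp [gridNeuron, Pi.single_apply, sub_eq_add_neg]
  -- First-layer rows have weight 1 and bias at most 2, hence `M₁ = 3`; `M₂` is of order `N` and
  -- `M₃` of order `N ^ d`.
  obtain ⟨θ, hθ, hκ, happθ⟩ := exists_clipped_net (I := Fin d × Fin (N + 3))
    (J := ProductIndex d r N k) hL hW3 hcard1 hcard2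
    (fun p => Pi.single p.1 1) (fun p => -((((p.2 : ℕ) : ℝ) - 1) / N)) a₂ b₂ a₃
    (M₁ := 3) (M₂ := 5 * (d + r) * N) (M₃ := 2 ^ d * B * (N : ℝ) ^ d) (by norm_num)
    (by
      have : (0 : ℝ) ≤ r := Nat.cast_nonneg r
      nlinarith)
    (fun p => by
      have h1 : ∑ q, |(Pi.single p.1 1 : Fin d → ℝ) q| = 1 := by
        simp [Pi.single_apply, apply_ite abs]
      have h2 : ((p.2 : ℕ) : ℝ) ≤ N + 2 := by exact_mod_cast Nat.lt_succ_iff.1 p.2.2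
      have h3 : (0 : ℝ) ≤ ((p.2 : ℕ) : ℝ) := Nat.cast_nonneg _
      have h4 : |-((((p.2 : ℕ) : ℝ) - 1) / N)| ≤ 2 := by
        rw [abs_neg, abs_div, Nat.abs_cast, div_le_iff₀ hN', abs_le]
        constructor <;> linarith
      rw [h1]
      linarith) hab₂ ha₃
  refine ⟨θ, hθ, ?_, fun x hx => ?_⟩
  · refine hκ.trans ?_
    have h1 : 2 ^ d * B * (N : ℝ) ^ d + 1 ≤ (2 ^ d * B + 1) * (N : ℝ) ^ d := by nlinarith
    calc 3 * (3 * (5 * (d + r) * N) * (2 ^ d * B * (N : ℝ) ^ d + 1))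
        ≤ 3 * (3 * (5 * (d + r) * N) * ((2 ^ d * B + 1) * (N : ℝ) ^ d)) := by gcongr
      _ = C₂ * (N : ℝ) ^ (d + 1) := by rw [hC₂]; ring
      _ ≤ (C₁ + C₂ + C₃) * (N : ℝ) ^ (d + 1) := by gcongr; linarith
  · have hf1 : |f x| ≤ 1 := by
      have := hf.2.1 0 (Nat.zero_le r) Fin.elim0 x
      rwa [mixedPartial_zero] at this
    refine (happθ x (f x) hf1).trans ?_
    let Q : (j : ℕ) → (Fin d ⊕ Fin j → ℝ) → ℝ := fun j u =>
      ∑ ε, ∑ l, w j ε l * max (∑ i, ((ε i : ℤ) : ℝ) * u i - τ j l) 0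
    have hloc : ∑ j, a₃ j * max (∑ i, a₂ j i * max (∑ q, (Pi.single i.1 1 : Fin d → ℝ) q * x q +
        -((((i.2 : ℕ) : ℝ) - 1) / N)) 0 + b₂ j) 0 = localTaylor N r f Q x := by
      simp only [hneuron, heq₂ _ x hx]
      rw [Fintype.sum_prod_type, localTaylor]
      refine Finset.sum_congr rfl fun m _ => ?_
      rw [Fintype.sum_sigma]
      refine Finset.sum_congr rfl fun j _ => ?_
      rw [Fintype.sum_prod_type]
      refine Finset.sum_congr rfl fun s _ => ?_
      rw [Fintype.sum_prod_type]
      simp only [Q, Finset.mul_sum]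
      refine Finset.sum_congr rfl fun ε _ => Finset.sum_congr rfl fun l _ => ?_
      simp only [a₃, pre]
      ring
    rw [hloc, abs_sub_comm]
    have hQE : ∀ j ≤ r, A j / (k : ℝ) ^ 2 ≤ E / (k : ℝ) ^ 2 := by
      intro j hj
      gcongr
      exact Finset.single_le_sum (f := fun j : Fin (r + 1) => A j) (fun j _ => (hA0 j).le)
        (Finset.mem_univ ⟨j, Nat.lt_succ_iff.2 hj⟩)
    refine (abs_sub_localTaylor_le hN hβ hf Q (E := E / (k : ℝ) ^ 2)
      (fun j hj u hu => (happ j u hu).trans (hQE j hj)) (fun j _ u hu => hzero j u hu) hx).trans ?_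
    have h1 : (0 : ℝ) ≤ (1 / N : ℝ) ^ r * (1 / N : ℝ) ^ β := by positivity
    have h2 : (0 : ℝ) ≤ 1 / (k : ℝ) ^ 2 := by positivity
    have h3 : (0 : ℝ) ≤ (d : ℝ) ^ r := by positivity
    have h4 : (0 : ℝ) ≤ 2 ^ d * (T * E) := by positivity
    calc _ = (d : ℝ) ^ r * ((1 / N : ℝ) ^ r * (1 / N : ℝ) ^ β) +
          2 ^ d * (T * E) * (1 / (k : ℝ) ^ 2) := by rw [← hT]; ring
      _ ≤ (C₁ + C₂ + C₃) * ((1 / N : ℝ) ^ r * (1 / N : ℝ) ^ β) +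
          (C₁ + C₂ + C₃) * (1 / (k : ℝ) ^ 2) := by
        gcongr <;> linarith
      _ = _ := by ring

end Approximation

/-- The approximation rate `K^{-α/(d+1)}`, parametrized by `K = ν^{d+1}`. -/
lemma exists_net_rate (d r : ℕ) (hd : 1 ≤ d) {α β : ℝ} (hβ : 0 < β) (hα : α = r + β) :
    ∃ C : ℝ, 1 ≤ C ∧ ∀ (ν : ℝ) (W L : ℕ), 1 ≤ ν → 3 ≤ L → C * ν ^ (d + α / 2) ≤ W →
      ∀ f ∈ HolderClass d r β, ∃ θ ∈ ReLUNet.boundedClass d 1 W L 1,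
        θ.kappa ≤ C * ν ^ ((d : ℝ) + 1) ∧
        ∀ x ∈ Set.Icc (0 : Fin d → ℝ) 1, |θ.eval x 0 - f x| ≤ C * ν ^ (-α) := by
  obtain ⟨C, hC1, hC⟩ := exists_net_grid d r hd hβ
  -- The factor `2 ^ (d + 1)` pays for rounding up `ν` and `η`, and for adding the two error terms.
  refine ⟨C * 2 ^ (d + 1), ?_, fun ν W L hν hL hW f hf => ?_⟩
  · have : (1 : ℝ) ≤ 2 ^ (d + 1) := one_le_pow₀ (by norm_num)
    nlinarith
  have hν0 : 0 < ν := by linarith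
  have hα0 : 0 < α := by rw [hα]; positivity
  -- With `k ≈ η` the product error `k⁻²` matches the Taylor error `ν ^ (-α)`.
  set η : ℝ := ν ^ (α / 2) with hη
  have hη1 : 1 ≤ η := Real.one_le_rpow hν (by linarith)
  have hceil : ∀ t : ℝ, 1 ≤ t → 0 < ⌈t⌉₊ ∧ t ≤ ⌈t⌉₊ ∧ (⌈t⌉₊ : ℝ) ≤ 2 * t := by
    intro t ht
    refine ⟨Nat.ceil_pos.2 (by linarith), Nat.le_ceil t, ?_⟩
    have := Nat.ceil_lt_add_one (by linarith : 0 ≤ t)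
    linarith
  obtain ⟨hN, hN1, hN2⟩ := hceil ν hν
  obtain ⟨hk, hk1, hk2⟩ := hceil η hη1
  obtain ⟨θ, hθ, hκ, happ⟩ := hC ⌈ν⌉₊ ⌈η⌉₊ W L hN hk hL (by
    refine le_trans ?_ hW
    calc C * ((⌈ν⌉₊ : ℝ) ^ d * ⌈η⌉₊) ≤ C * ((2 * ν) ^ d * (2 * η)) := by gcongr
      _ = C * 2 ^ (d + 1) * (ν ^ d * η) := by ring
      _ = C * 2 ^ (d + 1) * ν ^ (d + α / 2) := by
        rw [Real.rpow_add hν0, Real.rpow_natCast]) f hf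
  refine ⟨θ, hθ, hκ.trans ?_, fun x hx => (happ x hx).trans ?_⟩
  · calc C * (⌈ν⌉₊ : ℝ) ^ (d + 1) ≤ C * (2 * ν) ^ (d + 1) := by gcongr
      _ = C * 2 ^ (d + 1) * ν ^ (d + 1) := by ring
      _ = _ := by
        rw [← Real.rpow_natCast ν (d + 1)]
        push_cast
        rfl
  · have h1 : (1 / (⌈ν⌉₊ : ℝ)) ^ r * (1 / (⌈ν⌉₊ : ℝ)) ^ β ≤ ν ^ (-α) := by
      have hle : 1 / (⌈ν⌉₊ : ℝ) ≤ ν⁻¹ := by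
        rw [one_div]
        exact inv_anti₀ hν0 hN1
      calc (1 / (⌈ν⌉₊ : ℝ)) ^ r * (1 / (⌈ν⌉₊ : ℝ)) ^ β ≤ (ν⁻¹) ^ r * (ν⁻¹) ^ β := by gcongr
        _ = ν ^ (-α) := by
          rw [← Real.rpow_natCast, ← Real.rpow_add (by positivity), ← hα,
            Real.inv_rpow hν0.le, Real.rpow_neg hν0.le]
    have h2 : 1 / (⌈η⌉₊ : ℝ) ^ 2 ≤ ν ^ (-α) := by
      have h3 : η ^ 2 = ν ^ α := by
        rw [hη, ← Real.rpow_natCast, ← Real.rpow_mul hν0.le]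
        congr 1
        push_cast
        ring
      rw [Real.rpow_neg hν0.le, ← h3, one_div]
      exact inv_anti₀ (by positivity) (by gcongr)
    have h4 : (2 : ℝ) ≤ 2 ^ (d + 1) := le_self_pow₀ (by norm_num) (by omega)
    have h5 : (0 : ℝ) ≤ ν ^ (-α) := by positivity
    calc C * ((1 / (⌈ν⌉₊ : ℝ)) ^ r * (1 / (⌈ν⌉₊ : ℝ)) ^ β + 1 / (⌈η⌉₊ : ℝ) ^ 2)
        ≤ C * (ν ^ (-α) + ν ^ (-α)) := by gcongr
      _ = C * 2 * ν ^ (-α) := by ring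
      _ ≤ _ := by gcongr

lemma eLpNorm_two_sq {X : Type*} [MeasurableSpace X] {μ : Measure X} {h : X → ℝ}
    (hh : Integrable (fun x => h x ^ 2) μ) :
    eLpNorm h 2 μ ^ 2 = ENNReal.ofReal (∫ x, h x ^ 2 ∂μ) := by
  rw [ofReal_integral_eq_lintegral_ofReal hh (.of_forall fun x => sq_nonneg (h x)),
    eLpNorm_eq_lintegral_rpow_enorm_toReal (by norm_num) (by norm_num), ← ENNReal.rpow_natCast, ← ENNReal.rpow_mul]
  simp only [ENNReal.toReal_ofNat, Nat.cast_ofNat, one_div, inv_mul_cancel_of_invertible,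
    ENNReal.rpow_one]
  refine lintegral_congr fun x => ?_
  rw [← sq_abs, ENNReal.ofReal_pow (abs_nonneg _), ← Real.enorm_eq_ofReal_abs,
    ← ENNReal.rpow_natCast]
  norm_num

/-- The risk of an approximate minimizer is bounded by that of any competitor. -/
lemma IsApproxRegularizedERM.risk_le {d L n W : ℕ} {x : Fin n → Fin d → ℝ} {y : Fin n → ℝ}
    {lam ε : ℝ} {θ θ' : ReLUNet d 1 L} (hlam : 0 ≤ lam)
    (hθ : IsApproxRegularizedERM W x y lam ε θ) (hθ' : θ' ∈ ReLUNet.boundedClass d 1 W L 1) :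
    regularizedRisk x y lam θ ≤ regularizedRisk x y lam θ' + ε := by
  refine hθ.2.trans (add_le_add ?_ le_rfl)
  refine csInf_le ⟨0, ?_⟩ ⟨θ', hθ', rfl⟩
  rintro _ ⟨θ'', -, rfl⟩
  have := θ''.kappa_nonneg
  unfold regularizedRisk
  positivity

end

/-! ### Comparison with the competitor and conclusion. -/

theorem corollary4p4 (d r : ℕ) (hd : 1 ≤ d) (α β : ℝ) (hβ0 : 0 < β) (hβ1 : β ≤ 1)
    (hα : α = r + β) :
    ∃ c : ℝ, 0 < c ∧
      ∀ L : ℕ, 2 * ⌈Real.logb 2 ((d : ℝ) + r)⌉₊ + 3 ≤ L →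
      ∀ a₁ a₂ a₃ : ℝ, 0 < a₁ → 0 < a₂ → 0 < a₃ →
      ∃ C : ℝ, 0 < C ∧
        ∀ n : ℕ, 2 ≤ n →
        ∀ W : ℕ, c * (n : ℝ) ^ ((2 * d + α) / (4 * d + 8 * α + 4)) ≤ W →
        ∀ lam : ℝ, a₁ * (n : ℝ) ^ (-(1 / 2) : ℝ) ≤ lam → lam ≤ a₂ * (n : ℝ) ^ (-(1 / 2) : ℝ) →
        ∀ ε : ℝ, 0 ≤ ε → ε ≤ a₃ * (n : ℝ) ^ (-α / (d + 2 * α + 1)) →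
        ∀ f₀ ∈ HolderOnCube d r β,
        ∀ (μ : Measure (Fin d → ℝ)) [IsProbabilityMeasure μ], μ (Set.Icc 0 1)ᶜ = 0 →
        ∀ (Ω : Type*) [MeasurableSpace Ω] (P : Measure Ω) [IsProbabilityMeasure P]
          (X : Fin n → Ω → Fin d → ℝ), (∀ i, HasLaw (X i) μ P) → iIndepFun X P →
        ∀ θ : Ω → ReLUNet d 1 L,
          (∀ᵐ ω ∂P, IsApproxRegularizedERM W (fun i => X i ω) (fun i => f₀ (X i ω)) lam ε (θ ω)) →
          ∫⁻ ω, eLpNorm (fun x => (θ ω).eval x 0 - f₀ x) 2 μ ^ 2 ∂P ≤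
            ENNReal.ofReal (C * (n : ℝ) ^ (-α / (d + 2 * α + 1)) * Real.log n) := by
  obtain ⟨c, hc1, hc⟩ := exists_net_rate d r hd hβ0 hα
  refine ⟨c, by linarith, fun L hL a₁ a₂ a₃ ha₁ ha₂ ha₃ => ?_⟩
  have hL3 : 3 ≤ L := by omega
  have hc0 : 0 < c := by linarith
  have hα0 : 0 < α := by rw [hα]; positivity
  -- Squared approximation error, penalty of the competitor, and optimization error, in units of the
  -- rate.
  set D : ℝ := c ^ 2 + a₂ * c + a₃ with hD
  have hD0 : 0 < D := by positivity
  set D' : ℝ := D + 8 * ((D / a₁ + c) * (2 ^ L * (d + 1))) with hD'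
  have hD'0 : 0 < D' := by positivity
  have hlog2 : 0 < Real.log 2 := Real.log_pos one_lt_two
  refine ⟨D' / Real.log 2, by positivity, ?_⟩
  intro n hn W hW lam hlam₁ hlam₂ ε hε0 hε f₀ hf₀ μ _ hμ Ω _ P _ X hX hindep θ hθ
  obtain ⟨g, hg, hfg⟩ := hf₀
  have hn0 : (0 : ℝ) < n := by positivity
  have hn1 : (1 : ℝ) ≤ n := by exact_mod_cast (by omega : 1 ≤ n)
  set S : ℝ := d + 2 * α + 1 with hS
  have hS0 : 0 < S := by positivity
  set ν : ℝ := (n : ℝ) ^ (1 / (2 * S)) with hν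
  have hν1 : 1 ≤ ν := Real.one_le_rpow hn1 (by positivity)
  have hν0 : 0 < ν := by linarith
  have hνpow : ∀ t : ℝ, ν ^ t = (n : ℝ) ^ (t / (2 * S)) := by
    intro t
    rw [hν, ← Real.rpow_mul hn0.le]
    congr 1
    ring
  have hrate : (n : ℝ) ^ (-α / S) = ν ^ (-(2 * α)) := by
    rw [hνpow]
    congr 1
    field_simp
  have hhalf : (n : ℝ) ^ (-(1 / 2) : ℝ) = ν ^ (-S) := by
    rw [hνpow]
    congr 1
    field_simp
  have hsqrt : √(n : ℝ) = ν ^ S := by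
    rw [hνpow, Real.sqrt_eq_rpow]
    congr 1
    field_simp
  have hwidth : (n : ℝ) ^ ((2 * d + α) / (4 * d + 8 * α + 4)) = ν ^ (d + α / 2) := by
    rw [hνpow]
    congr 1
    rw [hS]
    have h1 : (4 * (d : ℝ) + 8 * α + 4) ≠ 0 := by positivity
    have h2 : ((d : ℝ) + 2 * α + 1) ≠ 0 := by positivity
    field_simp
    ring
  rw [hwidth] at hW
  rw [hhalf] at hlam₁ hlam₂
  rw [hrate] at hε ⊢
  set ρ : ℝ := ν ^ (-(2 * α)) with hρ
  have hρ0 : 0 < ρ := by positivity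
  -- The balance behind the choice of `ν`: penalty (and K/√n) and squared approximation error have
  -- the same order.
  have hρ1 : ν ^ (-S) * ν ^ ((d : ℝ) + 1) = ρ := by
    rw [← Real.rpow_add hν0]
    congr 1
    rw [hS]
    ring
  have hρ2 : (ν ^ (-α)) ^ 2 = ρ := by
    rw [← Real.rpow_natCast, ← Real.rpow_mul hν0.le]
    congr 1
    push_cast
    ring
  have hlam0 : 0 < lam := lt_of_lt_of_le (by positivity) hlam₁
  obtain ⟨θ₀, hθ₀, hκ₀, happ⟩ := hc ν W L hν1 hL3 hW g hg
  -- `D / a₁` covers the estimator, through the lower bound on `lam`; the summand `c` puts the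
  -- competitor in the ball as well.
  set K : ℝ := (D / a₁ + c) * ν ^ ((d : ℝ) + 1) with hK
  have hνd : 0 < ν ^ ((d : ℝ) + 1) := by positivity
  have hgc : Continuous g := hg.1.continuous
  have hg1 : ∀ x, |g x| ≤ 1 := by
    intro x
    have := hg.2.1 0 (Nat.zero_le r) Fin.elim0 x
    rwa [mixedPartial_zero] at this
  have hκ₀K : θ₀.kappa ≤ K := by
    refine hκ₀.trans ?_
    rw [hK]
    gcongr
    have : 0 < D / a₁ := by positivity
    linarith
  obtain ⟨G, hGint, hGle, hG⟩ := uniform_deviation (n := n) (by omega) g hgc hg1 μ hμ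
    ⟨θ₀, hθ₀, hκ₀K⟩
  have hGle' : ∫ x, G x ∂(Measure.pi fun _ : Fin n => μ) ≤
      8 * ((D / a₁ + c) * (2 ^ L * (d + 1))) * ρ := by
    refine hGle.trans (le_of_eq ?_)
    rw [hsqrt, ← hρ1, hK, Real.rpow_neg hν0.le]
    field_simp
  have hrisk : ∀ (x : Fin n → Fin d → ℝ) (θ' : ReLUNet d 1 L),
      (∀ i, x i ∈ Set.Icc (0 : Fin d → ℝ) 1) →
      IsApproxRegularizedERM W x (fun i => f₀ (x i)) lam ε θ' →
      (1 / (n : ℝ)) * ∑ i, (θ'.eval (x i) 0 - g (x i)) ^ 2 + lam * θ'.kappa ≤ D * ρ := by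
    intro x θ' hx hERM
    have hy : (fun i => f₀ (x i)) = fun i => g (x i) := funext fun i => hfg (hx i)
    rw [hy] at hERM
    refine (hERM.risk_le hlam0.le hθ₀).trans ?_
    have h1 : (1 / (n : ℝ)) * ∑ i, (θ₀.eval (x i) 0 - g (x i)) ^ 2 ≤ c ^ 2 * ρ := by
      have h2 : ∑ i, (θ₀.eval (x i) 0 - g (x i)) ^ 2 ≤ ∑ _i : Fin n, c ^ 2 * ρ := by
        refine Finset.sum_le_sum fun i _ => ?_
        rw [← sq_abs, ← hρ2, ← mul_pow]
        gcongr
        exact happ _ (hx i)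
      simp only [Finset.sum_const, Finset.card_univ, Fintype.card_fin, nsmul_eq_mul] at h2
      calc _ ≤ (1 / (n : ℝ)) * (n * (c ^ 2 * ρ)) := by gcongr
        _ = c ^ 2 * ρ := by field_simp
    have h3 : lam * θ₀.kappa ≤ a₂ * c * ρ := by
      calc lam * θ₀.kappa ≤ (a₂ * ν ^ (-S)) * (c * ν ^ ((d : ℝ) + 1)) := by
            gcongr
            exact θ₀.kappa_nonneg
        _ = a₂ * c * (ν ^ (-S) * ν ^ ((d : ℝ) + 1)) := by ring
        _ = a₂ * c * ρ := by rw [hρ1]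
    unfold regularizedRisk
    rw [hD]
    linarith
  have hκK : ∀ (x : Fin n → Fin d → ℝ) (θ' : ReLUNet d 1 L),
      (1 / (n : ℝ)) * ∑ i, (θ'.eval (x i) 0 - g (x i)) ^ 2 + lam * θ'.kappa ≤ D * ρ →
      θ'.kappa ≤ K := by
    intro x θ' h
    have h1 : (0 : ℝ) ≤ (1 / (n : ℝ)) * ∑ i, (θ'.eval (x i) 0 - g (x i)) ^ 2 := by positivity
    have h2 : (a₁ * ν ^ (-S)) * θ'.kappa ≤ D * (ν ^ (-S) * ν ^ ((d : ℝ) + 1)) := by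
      rw [hρ1]
      have := mul_le_mul_of_nonneg_right hlam₁ θ'.kappa_nonneg
      linarith
    have h3 : 0 < ν ^ (-S) := by positivity
    have h4 : a₁ * θ'.kappa ≤ D * ν ^ ((d : ℝ) + 1) := by
      refine le_of_mul_le_mul_left ?_ h3
      linarith
    have h5 : θ'.kappa ≤ D / a₁ * ν ^ ((d : ℝ) + 1) := by
      rw [div_mul_eq_mul_div, le_div_iff₀ ha₁]
      linarith
    refine h5.trans ?_
    rw [hK]
    gcongr
    linarith
  have hcube : ∀ᵐ x ∂μ, x ∈ Set.Icc (0 : Fin d → ℝ) 1 := by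
    rw [ae_iff]
    exact hμ
  have hXcube : ∀ᵐ ω ∂P, ∀ i, X i ω ∈ Set.Icc (0 : Fin d → ℝ) 1 := by
    rw [ae_all_iff]
    intro i
    refine ae_of_ae_map (hX i).aemeasurable ?_
    rw [(hX i).map_eq]
    exact hcube
  -- `G` dominates the deviation of all networks in the ball at once, so the dependence of `θ ω` on
  -- the sample is harmless and no measurability of `θ` is required.
  have hpt : ∀ᵐ ω ∂P, ∫ y, ((θ ω).eval y 0 - g y) ^ 2 ∂μ ≤ D * ρ + G (fun i => X i ω) ∧
      eLpNorm (fun x => (θ ω).eval x 0 - f₀ x) 2 μ ^ 2 =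
        ENNReal.ofReal (∫ y, ((θ ω).eval y 0 - g y) ^ 2 ∂μ) := by
    filter_upwards [hXcube, hθ] with ω hω hERM
    have h1 := hrisk _ _ hω hERM
    have h2 := hG (θ ω) hERM.1 (hκK _ _ h1) fun i => X i ω
    have h3 := mul_nonneg hlam0.le (θ ω).kappa_nonneg
    refine ⟨by linarith, ?_⟩
    have hcont : Continuous fun y => (θ ω).eval y 0 - g y :=
      ((continuous_apply 0).comp (θ ω).continuous_eval).sub hgc
    have hint : Integrable (fun y => ((θ ω).eval y 0 - g y) ^ 2) μ := by
      refine Integrable.of_bound (hcont.pow 2).aestronglyMeasurable 4 (.of_forall fun y => ?_)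
      have h4 := hERM.1.2 y 0
      have h5 := abs_le.1 (hg1 y)
      rw [Real.norm_eq_abs, abs_of_nonneg (sq_nonneg _)]
      calc _ ≤ (2 : ℝ) ^ 2 :=
            sq_le_sq' (by linarith only [h4.1, h5.2]) (by linarith only [h4.2, h5.1])
        _ = 4 := by norm_num
    rw [← eLpNorm_two_sq hint]
    congr 1
    refine eLpNorm_congr_ae ?_
    filter_upwards [hcube] with y hy
    rw [hfg hy]
  have hXae : ∀ i, AEMeasurable (X i) P := fun i => (hX i).aemeasurable
  have hjoint : P.map (fun ω i => X i ω) = Measure.pi fun _ : Fin n => μ := by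
    rw [(iIndepFun_iff_map_fun_eq_pi_map hXae).1 hindep]
    congr 1
    funext i
    exact (hX i).map_eq
  have hXm : AEMeasurable (fun ω i => X i ω) P := aemeasurable_pi_lambda _ hXae
  have hGX : Integrable (fun ω => G fun i => X i ω) P := by
    have h1 : Integrable G (P.map fun ω i => X i ω) := by rw [hjoint]; exact hGint
    exact h1.comp_aemeasurable hXm
  have hGXint : ∫ ω, G (fun i => X i ω) ∂P = ∫ x, G x ∂(Measure.pi fun _ : Fin n => μ) := by
    rw [← hjoint, integral_map hXm (by rw [hjoint]; exact hGint.aestronglyMeasurable)]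
  have hbound : Integrable (fun ω => D * ρ + G fun i => X i ω) P := (integrable_const _).add hGX
  calc ∫⁻ ω, eLpNorm (fun x => (θ ω).eval x 0 - f₀ x) 2 μ ^ 2 ∂P
      ≤ ∫⁻ ω, ENNReal.ofReal (D * ρ + G fun i => X i ω) ∂P := by
        refine lintegral_mono_ae (hpt.mono fun ω hω => ?_)
        rw [hω.2]
        exact ENNReal.ofReal_le_ofReal hω.1
    _ = ENNReal.ofReal (∫ ω, (D * ρ + G fun i => X i ω) ∂P) := by
        rw [ofReal_integral_eq_lintegral_ofReal hbound]
        exact hpt.mono fun ω hω => (integral_nonneg fun y => sq_nonneg _).trans hω.1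
    _ ≤ _ := by
        refine ENNReal.ofReal_le_ofReal ?_
        rw [integral_add (integrable_const _) hGX, hGXint]
        simp only [integral_const, probReal_univ, one_smul]
        -- The bound already holds without a logarithm; the factor is inserted using `log n ≥ log
        -- 2`.
        have hlogn : Real.log 2 ≤ Real.log n := Real.log_le_log two_pos (by exact_mod_cast hn)
        have h1 : (1 : ℝ) ≤ Real.log n / Real.log 2 := (one_le_div hlog2).2 hlogn
        calc D * ρ + ∫ x, G x ∂(Measure.pi fun _ : Fin n => μ) ≤ D' * ρ := by
              rw [hD']; linarith
          _ ≤ D' * ρ * (Real.log n / Real.log 2) := le_mul_of_one_le_right (by positivity) h1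
          _ = D' / Real.log 2 * ρ * Real.log n := by ring
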